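/- An election $E=(C,V)$ consists of a finite set $C$ of $m$ candidates and a collection $V=(v_1,\dots,v_n)$, $n\ge 1$, of rankings (strict total orders) of $C$. For $c\in C$ let $\mathrm{freq}_E(c)\in\mathbb{R}^m$ be the vector whose $i$-th entry is the fraction of the voters that rank $c$ on position $i$. For nonnegative vectors $x,y\in\mathbb{R}^m$ with equal sums of entries, the earth mover's distance $\mathrm{emd}(x,y)$ is the lowest total cost of a finite sequence of operations that transforms $x$ into $y$, where an operation subtracts some $\delta\ge 0$ from position $i$ and adds $\delta$ to position $j$, costs $\delta\cdot|i-j|$, and is legal if the current value at position $i$ is at least $\delta$. For elections $E=(C,V)$ and $F=(D,U)$ with $|C|=|D|$ (but possibly $|V|\ne|U|$), the positionwise distance is \[ \mathrm{POS}(E,F)=\min_{\delta}\ \sum_{c\in C}\mathrm{emd}\bigl(\mathrm{freq}_E(c),\mathrm{freq}_F(\delta(c))\bigr), \] the minimum being taken over all bijections $\delta\colon C\to D$. Proposition. There is a polynomial-time algorithm for computing the positionwise distance: there are a program $P$ for a random access machine and a polynomial $p$ such that, for all elections $E=(C,V)$ and $F=(D,U)$ with $|C|=|D|=m$, $|V|=n\ge1$,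 $|U|=k\ge1$, and all numberings of $C$ and of $D$ by $0,\dots,m-1$, the program $P$, started on the input consisting of the numbers $m,n,k$ followed by all votes of $E$ and all votes of $F$ (each written as the list of the numbers of its candidates, from the top-ranked to the bottom-ranked one), halts after a run of cost at most $p(N)$ and outputs natural numbers $a$ and $b>0$ with $\mathrm{POS}(E,F)=a/b$. Here $N$ is the bit size of the input, and the cost of a run is measured by the logarithmic cost criterion (each operation costs one unit plus the bit lengths of the numbers involved), so that polynomial time here is polynomial time in the usual Turing machine sense. -/

import Mathlib

/-! ### Elections, frequency vectors, earth mover's distance, positionwise distance -/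

/-- A preference order over the candidate set `C` (with `m` candidates): the candidate on each
position, from the most desirable one (position `0`) to the least desirable one. -/
abbrev Ranking (C : Type*) (m : ℕ) := Fin m ≃ C

/-- The position of candidate `c` in the preference order `v` (counted from `0`). -/
def Ranking.pos {C : Type*} {m : ℕ} (v : Ranking C m) (c : C) : Fin m := v.symm c

/-- An election with candidate set `C`, where `|C| = m`, and voters `v_1, …, v_n`. -/
structure Election (C : Type*) (m n : ℕ) where
  vote : Fin n → Ranking C m

/-- The number of voters that rank candidate `c` on position `i`. -/
def Election.posCount {C : Type*} {m n : ℕ} (E : Election C m n) (c : C) (i : Fin m) : ℕ :=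
  (Finset.univ.filter fun v : Fin n => Ranking.pos (E.vote v) c = i).card

/-- The frequency vector of candidate `c`: the fraction of the voters ranking `c` on each
position. -/
noncomputable def Election.freq {C : Type*} {m n : ℕ} (E : Election C m n) (c : C) : Fin m → ℝ :=
  fun i => (E.posCount c i : ℝ) / (n : ℝ)

/-- `MovesTo x y c`: the vector `x` can be transformed into the vector `y`, at total cost `c`, by a
finite sequence of legal operations. An operation subtracts `δ ≥ 0` from position `i` and adds `δ`
to position `j`; it costs `δ * |i - j|`, and is legal if the current value at position `i` is at
least `δ`. -/
inductive MovesTo {t : ℕ} (x : Fin t → ℝ) : (Fin t → ℝ) → ℝ → Prop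
  | refl : MovesTo x x 0
  | step {y : Fin t → ℝ} {c : ℝ} (i j : Fin t) (δ : ℝ) :
      MovesTo x y c → 0 ≤ δ → δ ≤ y i →
      MovesTo x (y - Pi.single i δ + Pi.single j δ) (c + δ * |((i : ℕ) : ℝ) - ((j : ℕ) : ℝ)|)

/-- The earth mover's distance of two nonnegative vectors with the same sum of entries: the lowest
total cost of operations that transform `x` into `y`. -/
noncomputable def emd {t : ℕ} (x y : Fin t → ℝ) : ℝ := sInf {c : ℝ | MovesTo x y c}

/-- `δ-POS(E, F)` for a candidate matching `δ`. -/
noncomputable def posDistVia {C D : Type*} [Fintype C] {m n k : ℕ}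
    (E : Election C m n) (F : Election D m k) (δ : C ≃ D) : ℝ :=
  ∑ c : C, emd (E.freq c) (F.freq (δ c))

/-- The positionwise distance `POS(E, F)`: the minimum of `δ-POS(E, F)` over the (finite, nonempty)
set of bijections `δ` from `C` to `D`. -/
noncomputable def posDist {C D : Type*} [Fintype C] {m n k : ℕ}
    (E : Election C m n) (F : Election D m k) : ℝ :=
  ⨅ δ : C ≃ D, posDistVia E F δ

/-! ### Random access machines with logarithmic cost -/

namespace RAM

/-- Memory: registers, and arrays of unbounded length, all holding natural numbers of unbounded
size. A program names its registers and arrays by constants, so it uses only finitely many of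
them; the cells of an array are addressed by computed indices. -/
structure State where
  reg : ℕ → ℕ
  arr : ℕ → ℕ → ℕ

/-- Expressions: constants, register contents, array cells, and the arithmetic operations
(`sub` is truncated subtraction, `div` is division rounded down, with value `0` for divisor `0`). -/
inductive Term where
  | const (k : ℕ)
  | reg (r : ℕ)
  | get (a : ℕ) (i : Term)
  | add (e f : Term)
  | sub (e f : Term)
  | mul (e f : Term)
  | div (e f : Term)

/-- The value of an expression. -/
def Term.eval (s : State) : Term → ℕ
  | .const k => k
  | .reg r => s.reg r
  | .get a i => s.arr a (i.eval s)
  | .add e f => e.eval s + f.eval s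
  | .sub e f => e.eval s - f.eval s
  | .mul e f => e.eval s * f.eval s
  | .div e f => e.eval s / f.eval s

/-- The cost of evaluating an expression: each operation is charged one unit plus the bit lengths
of its operands (indices included) and of its result. The bit lengths of the operands are part of
the costs of the subexpressions. -/
def Term.cost (s : State) : Term → ℕ
  | .const k => 1 + Nat.size k
  | .reg r => 1 + Nat.size (s.reg r)
  | .get a i => 1 + Nat.size (s.arr a (i.eval s)) + i.cost s
  | .add e f => 1 + Nat.size (e.eval s + f.eval s) + e.cost s + f.cost s
  | .sub e f => 1 + Nat.size (e.eval s - f.eval s) + e.cost s + f.cost s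
  | .mul e f => 1 + Nat.size (e.eval s * f.eval s) + e.cost s + f.cost s
  | .div e f => 1 + Nat.size (e.eval s / f.eval s) + e.cost s + f.cost s

/-- Programs. A test succeeds if the value of its expression is not `0`. -/
inductive Prog where
  | skip
  | assign (r : ℕ) (e : Term)
  | store (a : ℕ) (i e : Term)
  | seq (P Q : Prog)
  | ite (b : Term) (P Q : Prog)
  | loop (b : Term) (P : Prog)

/-- `Exec P s s' t`: the program `P`, started in the memory state `s`, halts in the memory state
`s'`, and the run has cost `t`. The command `loop b P` is `while b ≠ 0 do P`. -/
inductive Exec : Prog → State → State → ℕ → Prop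
  | skip (s : State) : Exec .skip s s 1
  | assign (s : State) (r : ℕ) (e : Term) :
      Exec (.assign r e) s { s with reg := Function.update s.reg r (e.eval s) } (1 + e.cost s)
  | store (s : State) (a : ℕ) (i e : Term) :
      Exec (.store a i e) s
        { s with arr := Function.update s.arr a
                  (Function.update (s.arr a) (i.eval s) (e.eval s)) }
        (1 + i.cost s + e.cost s)
  | seq {P Q : Prog} {s s' s'' : State} {t t' : ℕ} :
      Exec P s s' t → Exec Q s' s'' t' → Exec (.seq P Q) s s'' (t + t')
  | ite_true {b : Term} {P Q : Prog} {s s' : State} {t : ℕ} :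
      b.eval s ≠ 0 → Exec P s s' t → Exec (.ite b P Q) s s' (1 + b.cost s + t)
  | ite_false {b : Term} {P Q : Prog} {s s' : State} {t : ℕ} :
      b.eval s = 0 → Exec Q s s' t → Exec (.ite b P Q) s s' (1 + b.cost s + t)
  | loop_true {b : Term} {P : Prog} {s s' s'' : State} {t t' : ℕ} :
      b.eval s ≠ 0 → Exec P s s' t → Exec (.loop b P) s' s'' t' →
      Exec (.loop b P) s s'' (1 + b.cost s + t + t')
  | loop_false {b : Term} {P : Prog} {s : State} :
      b.eval s = 0 → Exec (.loop b P) s s (1 + b.cost s)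

/-- The initial memory on input `w`: array `0` holds the word `w`, register `0` its length, and
everything else is `0`. -/
def init (w : List ℕ) : State where
  reg := fun r => if r = 0 then w.length else 0
  arr := fun a i => if a = 0 then w.getD i 0 else 0

/-- The size of an input word: the bit lengths of its numbers, plus one (a separator) for each. -/
def inputSize (w : List ℕ) : ℕ := (w.map fun a => Nat.size a + 1).sum

end RAM

/-! ### Elections as inputs of an algorithm -/

/-- The votes of an election one after another, each as the list of its candidates from the most to
the least desirable one; `e` is the numbering of the candidates by `0, …, m - 1` that is used. -/
def Election.encode {C : Type*} {m n : ℕ} (e : C ≃ Fin m) (E : Election C m n) : List ℕ :=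
  (List.ofFn fun v : Fin n => List.ofFn fun i : Fin m => ((e (E.vote v i) : Fin m) : ℕ)).flatten

/-- A pair of elections as an input word: the number of candidates, the two numbers of voters, and
the votes of the two elections. -/
def encodePair {C D : Type*} {m n k : ℕ} (eC : C ≃ Fin m) (E : Election C m n)
    (eD : D ≃ Fin m) (F : Election D m k) : List ℕ :=
  m :: n :: k :: (E.encode eC ++ F.encode eD)

/-! On a line the earth mover's distance is the sum, over all positions, of the absolute differences
of prefix sums (`emd_eq_prefixDist`). Moving `δ` from `i` to `j` changes `|i - j|` prefix sums by
`δ` each, so no sequence of operations is cheaper; moves between neighbours that repair one prefix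
sum at a time attain the value. For frequency vectors with denominators `n` and `k`, multiplication
by `n * k` turns these distances into natural numbers `matchWeight`, and the positionwise distance
is a minimum-weight perfect matching divided by `n * k` (`posDist_eq_div`).

The matching is found by an auction. Weights are scaled by `m + 1`; the bidding row takes the column
that minimises scaled weight plus price and raises that price by 1. Every owner stays within 1 of
its best choice, so the final assignment is within `m` of the optimum, while scaled totals are
multiples of `m + 1`: it is optimal (`AuctionInv.optimal`). As long as a row is missing, some column
is unowned and has price 0, which caps all prices; each bid increases the sum of prices by 1, which
caps the number of bids (`AuctionInv.bid`). The resulting bound is polynomial in the weights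
themselves, not in their bit lengths. This suffices because all votes are written out: for `m > 0`
the weights are polynomial in the input length.

For the running time, a single number `M` bounds all memory contents and all round counts. The cost
is then at most a polynomial in `M` that depends only on the program (`Prog.exists_timeBound_eq`),
and `M = 10 * N ^ 5` is large enough (`large_of_le`). -/

/-! ### The earth mover's distance as a sum of differences of prefix sums -/

section EarthMover

variable {t : ℕ}

/-- The sum of the entries of `x` up to position `l`. -/
def prefixSum (x : Fin t → ℝ) (l : Fin t) : ℝ := ∑ i ∈ Finset.Iic l, x i

/-- The sum of the absolute differences of the prefix sums of `x` and `y`. -/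
noncomputable def prefixDist (x y : Fin t → ℝ) : ℝ := ∑ l, |prefixSum x l - prefixSum y l|

lemma prefixSum_add (x y : Fin t → ℝ) (l : Fin t) :
    prefixSum (x + y) l = prefixSum x l + prefixSum y l := by
  simp [prefixSum, Finset.sum_add_distrib]

lemma prefixSum_sub (x y : Fin t → ℝ) (l : Fin t) :
    prefixSum (x - y) l = prefixSum x l - prefixSum y l := by
  simp [prefixSum, Finset.sum_sub_distrib]

lemma prefixSum_single (i : Fin t) (δ : ℝ) (l : Fin t) :
    prefixSum (Pi.single i δ) l = if i ≤ l then δ else 0 := by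
  simp [prefixSum]

lemma prefixSum_eq_add (x : Fin t → ℝ) (l : Fin t) :
    prefixSum x l = x l + ∑ i ∈ Finset.Iio l, x i := by
  rw [prefixSum, ← Finset.Iio_insert, Finset.sum_insert (by simp)]

lemma prefixSum_succ (x : Fin t → ℝ) {p l : Fin t} (h : (p : ℕ) + 1 = l) :
    prefixSum x l = x l + prefixSum x p := by
  rw [prefixSum_eq_add, prefixSum]
  congr 2
  ext i
  simp only [Finset.mem_Iio, Finset.mem_Iic, Fin.lt_def, Fin.le_def]
  omega

lemma prefixSum_zero (x : Fin t → ℝ) {l : Fin t} (h : (l : ℕ) = 0) : prefixSum x l = x l := by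
  rw [prefixSum_eq_add, Finset.sum_eq_zero, add_zero]
  intro i hi
  simp only [Finset.mem_Iio, Fin.lt_def] at hi
  omega

lemma prefixSum_injective : Function.Injective (prefixSum (t := t)) := by
  intro x y h
  funext l
  have hl := congrFun h l
  rcases Nat.eq_zero_or_pos (l : ℕ) with h0 | h0
  · rwa [prefixSum_zero x h0, prefixSum_zero y h0] at hl
  · have hp : ((⟨l - 1, by omega⟩ : Fin t) : ℕ) + 1 = l := by simp; omega
    rw [prefixSum_succ x hp, prefixSum_succ y hp, congrFun h] at hl
    linarith

/-- The two indicators differ exactly on the half-open interval between the indices. This identifies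
the cost of moving one unit with the total change of the prefix sums. -/
lemma sum_abs_indicator_sub (i j : Fin t) :
    ∑ l : Fin t, |(if i ≤ l then (1 : ℝ) else 0) - (if j ≤ l then 1 else 0)| =
      |((i : ℕ) : ℝ) - ((j : ℕ) : ℝ)| := by
  wlog h : i ≤ j generalizing i j
  · rw [abs_sub_comm, ← this j i (le_of_not_ge h)]
    exact Finset.sum_congr rfl fun l _ => abs_sub_comm _ _
  have h' : ((i : ℕ) : ℝ) ≤ ((j : ℕ) : ℝ) := by exact_mod_cast h
  have key : ∀ l : Fin t, |(if i ≤ l then (1 : ℝ) else 0) - (if j ≤ l then 1 else 0)| =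
      if l ∈ Finset.Ico i j then 1 else 0 := by
    intro l
    simp only [Finset.mem_Ico]
    by_cases h1 : i ≤ l <;> by_cases h2 : j ≤ l
    · simp [h1, h2]
    · simp [h1, h2, lt_of_not_ge h2]
    · exact absurd (h.trans h2) h1
    · simp [h1, h2]
  rw [Finset.sum_congr rfl fun l _ => key l, Finset.sum_ite_mem, Finset.univ_inter]
  rw [Finset.sum_const, Fin.card_Ico, nsmul_eq_mul, mul_one, Nat.cast_sub (by exact_mod_cast h),
    abs_sub_comm, abs_of_nonneg (by linarith)]

/-- By the triangle inequality, one operation increases `prefixDist` from the starting vector by at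
most its own cost. -/
lemma MovesTo.prefixDist_le {x y : Fin t → ℝ} {c : ℝ} (h : MovesTo x y c) :
    prefixDist x y ≤ c := by
  induction h with
  | refl => simp [prefixDist]
  | @step y c i j δ _ hδ _ ih =>
    refine le_trans ?_ (add_le_add_left ih _)
    rw [← sum_abs_indicator_sub, Finset.mul_sum, prefixDist, prefixDist, ← Finset.sum_add_distrib]
    refine Finset.sum_le_sum fun l _ => ?_
    rw [prefixSum_add, prefixSum_sub, prefixSum_single, prefixSum_single]
    have e : prefixSum x l -
        (prefixSum y l - (if i ≤ l then δ else 0) + (if j ≤ l then δ else 0)) =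
        (prefixSum x l - prefixSum y l) +
          δ * ((if i ≤ l then (1 : ℝ) else 0) - (if j ≤ l then 1 else 0)) := by
      split_ifs <;> ring
    rw [e]
    refine (abs_add_le _ _).trans ?_
    rw [abs_mul, abs_of_nonneg hδ]

lemma MovesTo.trans {x y z : Fin t → ℝ} {c d : ℝ} (h : MovesTo x y c) (h' : MovesTo y z d) :
    MovesTo x z (c + d) := by
  induction h' with
  | refl => simpa using h
  | step i j δ _ h0 h1 ih => rw [← add_assoc]; exact ih.step i j δ h0 h1

lemma MovesTo.single {x : Fin t → ℝ} {i j : Fin t} {δ : ℝ} (h0 : 0 ≤ δ) (h1 : δ ≤ x i)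
    (hij : |((i : ℕ) : ℝ) - ((j : ℕ) : ℝ)| = 1) :
    MovesTo x (x - Pi.single i δ + Pi.single j δ) δ := by
  simpa [hij] using MovesTo.refl.step i j δ h0 h1

lemma sub_single_add_single_nonneg {x : Fin t → ℝ} (hx : 0 ≤ x) {i j : Fin t} {δ : ℝ}
    (h0 : 0 ≤ δ) (h1 : δ ≤ x i) : 0 ≤ x - Pi.single i δ + Pi.single j δ := by
  intro l
  have hl : 0 ≤ x l := hx l
  have hj : 0 ≤ (Pi.single j δ : Fin t → ℝ) l := by
    rw [Pi.single_apply]; split_ifs <;> simp [h0]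
  have hi : (Pi.single i δ : Fin t → ℝ) l ≤ x l := by
    rcases eq_or_ne l i with rfl | h
    · simpa using h1
    · simpa [h] using hl
  simp only [Pi.zero_apply, Pi.add_apply, Pi.sub_apply]
  linarith

/-- If `x` and `y` differ, then some move between neighbouring positions of `x` makes one more
prefix sum agree with that of `y`, and leaves the other prefix sums unchanged. -/
lemma exists_adjacent_move {x y : Fin t → ℝ} (hx : 0 ≤ x) (hy : 0 ≤ y)
    (hlast : ∀ l : Fin t, (l : ℕ) + 1 = t → prefixSum x l = prefixSum y l)
    (hne : ∃ l, prefixSum x l ≠ prefixSum y l) :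
    ∃ (l : Fin t) (x' : Fin t → ℝ), prefixSum x l ≠ prefixSum y l ∧ 0 ≤ x' ∧
      MovesTo x x' |prefixSum x l - prefixSum y l| ∧
      prefixSum x' = Function.update (prefixSum x) l (prefixSum y l) := by
  have hsucc : ∀ l : Fin t, prefixSum x l ≠ prefixSum y l → (l : ℕ) + 1 < t := by
    intro l hl
    by_contra h
    exact hl (hlast l (by omega))
  by_cases hpos : ∃ l, prefixSum y l < prefixSum x l
  -- At the least position with a surplus, the preceding prefix (if any) has none. Hence the whole
  -- surplus `δ` is contained in `x l` and can be pushed to the right.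
  · obtain ⟨l, hl, hmin⟩ := WellFounded.has_min (wellFounded_lt (α := Fin t))
      {l | prefixSum y l < prefixSum x l} hpos
    have hl : prefixSum y l < prefixSum x l := hl
    set δ := prefixSum x l - prefixSum y l with hδ
    have h0 : 0 ≤ δ := by linarith
    have hyl : 0 ≤ y l := hy l
    have h1 : δ ≤ x l := by
      rcases Nat.eq_zero_or_pos (l : ℕ) with hz | hz
      · rw [hδ, prefixSum_zero x hz, prefixSum_zero y hz]; linarith
      · have hp : ((⟨l - 1, by omega⟩ : Fin t) : ℕ) + 1 = l := by simp; omega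
        have : prefixSum x ⟨l - 1, by omega⟩ ≤ prefixSum y ⟨l - 1, by omega⟩ :=
          not_lt.mp fun h => hmin _ h (by rw [Fin.lt_def]; simp; omega)
        rw [hδ, prefixSum_succ x hp, prefixSum_succ y hp]; linarith
    have ht := hsucc l hl.ne'
    refine ⟨l, x - Pi.single l δ + Pi.single ⟨l + 1, ht⟩ δ, hl.ne',
      sub_single_add_single_nonneg hx h0 h1, ?_, ?_⟩
    · rw [abs_of_nonneg h0]
      exact MovesTo.single h0 h1 (by simp)
    · funext i
      rw [prefixSum_add, prefixSum_sub, prefixSum_single, prefixSum_single]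
      rcases eq_or_ne i l with rfl | h
      · simp [Fin.le_def, hδ]
      · have hv : (i : ℕ) ≠ l := fun e => h (Fin.ext e)
        rw [Function.update_of_ne h]
        by_cases hil : l ≤ i
        · have : (⟨l + 1, ht⟩ : Fin t) ≤ i := by rw [Fin.le_def] at *; simp; omega
          simp [hil, this]
        · have : ¬ (⟨l + 1, ht⟩ : Fin t) ≤ i := by rw [Fin.le_def] at *; simp; omega
          simp [hil, this]
  · push Not at hpos
    -- Without any surplus, take the last position with a deficit. The prefix sums agree at `l + 1`,
    -- so `x` exceeds `y` there by exactly `δ`, which can be pulled to the left.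
    obtain ⟨l, hl, hmax⟩ := WellFounded.has_min (wellFounded_gt (α := Fin t))
      {l | prefixSum x l ≠ prefixSum y l} hne
    have hl : prefixSum x l ≠ prefixSum y l := hl
    have hl' : prefixSum x l < prefixSum y l := lt_of_le_of_ne (hpos l) hl
    set δ := prefixSum y l - prefixSum x l with hδ
    have h0 : 0 ≤ δ := by linarith
    have ht := hsucc l hl
    have hyl : 0 ≤ y ⟨l + 1, ht⟩ := hy _
    have h1 : δ ≤ x ⟨l + 1, ht⟩ := by
      have := not_not.mp (fun h => hmax ⟨l + 1, ht⟩ h (by rw [Fin.lt_def]; simp))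
      rw [prefixSum_succ x (p := l) rfl, prefixSum_succ y (p := l) rfl] at this
      linarith
    refine ⟨l, x - Pi.single ⟨l + 1, ht⟩ δ + Pi.single l δ, hl,
      sub_single_add_single_nonneg hx h0 h1, ?_, ?_⟩
    · rw [abs_sub_comm, abs_of_nonneg h0]
      exact MovesTo.single h0 h1 (by simp)
    · funext i
      rw [prefixSum_add, prefixSum_sub, prefixSum_single, prefixSum_single]
      rcases eq_or_ne i l with rfl | h
      · simp [Fin.le_def, hδ]
      · have hv : (i : ℕ) ≠ l := fun e => h (Fin.ext e)
        rw [Function.update_of_ne h]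
        by_cases hil : l ≤ i
        · have : (⟨l + 1, ht⟩ : Fin t) ≤ i := by rw [Fin.le_def] at *; simp; omega
          simp [hil, this]
        · have : ¬ (⟨l + 1, ht⟩ : Fin t) ≤ i := by rw [Fin.le_def] at *; simp; omega
          simp [hil, this]

/-- Induction on the number of disagreeing prefix sums: each neighbouring move removes one of them,
at a cost equal to its term in `prefixDist`. -/
lemma movesTo_prefixDist {x y : Fin t → ℝ} (hx : 0 ≤ x) (hy : 0 ≤ y)
    (hlast : ∀ l : Fin t, (l : ℕ) + 1 = t → prefixSum x l = prefixSum y l) :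
    MovesTo x y (prefixDist x y) := by
  induction hn : (Finset.univ.filter fun l => prefixSum x l ≠ prefixSum y l).card
    using Nat.strong_induction_on generalizing x with
  | _ n ih =>
  by_cases hne : ∃ l, prefixSum x l ≠ prefixSum y l
  · obtain ⟨l, x', hl, hx', hm, hs⟩ := exists_adjacent_move hx hy hlast hne
    have hlast' : ∀ i : Fin t, (i : ℕ) + 1 = t → prefixSum x' i = prefixSum y i := by
      intro i hi
      rw [hs, Function.update_apply]
      split_ifs with h
      · rw [h]
      · exact hlast i hi
    have hlt : (Finset.univ.filter fun i => prefixSum x' i ≠ prefixSum y i).card < n := by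
      rw [← hn]
      refine Finset.card_lt_card (Finset.ssubset_iff_of_subset ?_ |>.mpr ⟨l, ?_, ?_⟩)
      · intro i
        simp only [Finset.mem_filter, Finset.mem_univ, true_and, hs, Function.update_apply]
        split_ifs with h
        · simp [h]
        · exact id
      · simpa using hl
      · simp [hs]
    have h := hm.trans (ih _ hlt hx' hlast' rfl)
    convert h using 1
    rw [prefixDist, prefixDist, ← Finset.add_sum_erase _ _ (Finset.mem_univ l),
      ← Finset.add_sum_erase Finset.univ (fun i => |prefixSum x' i - _|) (Finset.mem_univ l)]
    have : |prefixSum x' l - prefixSum y l| = 0 := by simp [hs]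
    rw [this, zero_add]
    congr 1
    refine Finset.sum_congr rfl fun i hi => ?_
    rw [hs, Function.update_of_ne (Finset.ne_of_mem_erase hi)]
  · push Not at hne
    have : x = y := prefixSum_injective (funext hne)
    subst this
    simpa [prefixDist] using MovesTo.refl (x := x)

theorem emd_eq_prefixDist {x y : Fin t → ℝ} (hx : 0 ≤ x) (hy : 0 ≤ y)
    (hsum : ∑ i, x i = ∑ i, y i) : emd x y = prefixDist x y := by
  refine IsLeast.csInf_eq ⟨movesTo_prefixDist hx hy fun l hl => ?_, fun c hc => hc.prefixDist_le⟩
  have : Finset.Iic l = Finset.univ := by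
    ext i
    simp only [Finset.mem_Iic, Finset.mem_univ, iff_true, Fin.le_def]
    omega
  rw [prefixSum, prefixSum, this, hsum]

end EarthMover

/-! ### Running time of programs on states with bounded contents -/

namespace RAM

/-- All memory cells hold numbers that are at most `M`. -/
def State.Bdd (M : ℕ) (s : State) : Prop :=
  (∀ r, s.reg r ≤ M) ∧ ∀ a i, s.arr a i ≤ M

/-- The state after writing `v` into register `r`. -/
def State.setReg (s : State) (r v : ℕ) : State := { s with reg := Function.update s.reg r v }

/-- The state after writing `v` into cell `i` of array `a`. -/
def State.setArr (s : State) (a i v : ℕ) : State :=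
  { s with arr := Function.update s.arr a (Function.update (s.arr a) i v) }

@[simp] lemma State.setReg_arr (s : State) (r v : ℕ) : (s.setReg r v).arr = s.arr := rfl

@[simp] lemma State.setArr_reg (s : State) (a i v : ℕ) : (s.setArr a i v).reg = s.reg := rfl

lemma State.setReg_reg (s : State) (r v r' : ℕ) :
    (s.setReg r v).reg r' = if r' = r then v else s.reg r' := by
  simp [State.setReg, Function.update_apply]

lemma State.setArr_arr (s : State) (a i v a' : ℕ) :
    (s.setArr a i v).arr a' = if a' = a then Function.update (s.arr a) i v else s.arr a' := by
  simp [State.setArr, Function.update_apply]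

lemma State.Bdd.setReg {M : ℕ} {s : State} (h : s.Bdd M) {r v : ℕ} (hv : v ≤ M) :
    (s.setReg r v).Bdd M := by
  refine ⟨fun r' => ?_, h.2⟩
  rw [State.setReg_reg]
  split_ifs
  · exact hv
  · exact h.1 r'

lemma State.Bdd.setArr {M : ℕ} {s : State} (h : s.Bdd M) {a i v : ℕ} (hv : v ≤ M) :
    (s.setArr a i v).Bdd M := by
  refine ⟨h.1, fun a' i' => ?_⟩
  rw [State.setArr_arr]
  split_ifs
  · rw [Function.update_apply]
    split_ifs
    · exact hv
    · exact h.2 a i'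
  · exact h.2 a' i'

/-! ### Polynomial bounds on values and running times -/

/-- A bound on the value of an expression in a memory whose cells hold at most `M`. -/
def Term.valBound (M : ℕ) : Term → ℕ
  | .const k => k
  | .reg _ => M
  | .get _ _ => M
  | .add e f => e.valBound M + f.valBound M
  | .sub e _ => e.valBound M
  | .mul e f => e.valBound M * f.valBound M
  | .div e _ => e.valBound M

/-- A bound on the cost of an expression in a memory whose cells hold at most `M`. -/
def Term.costBound (M : ℕ) : Term → ℕ
  | .const k => 1 + k
  | .reg _ => 1 + M
  | .get _ i => 1 + M + i.costBound M
  | .add e f => 1 + (e.valBound M + f.valBound M) + e.costBound M + f.costBound M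
  | .sub e f => 1 + e.valBound M + e.costBound M + f.costBound M
  | .mul e f => 1 + e.valBound M * f.valBound M + e.costBound M + f.costBound M
  | .div e f => 1 + e.valBound M + e.costBound M + f.costBound M

/-- A bound on the cost of a run of a program during which all memory cells hold at most `M` and
each loop makes at most `M` rounds. -/
def Prog.timeBound (M : ℕ) : Prog → ℕ
  | .skip => 1
  | .assign _ e => 1 + e.costBound M
  | .store _ i e => 1 + i.costBound M + e.costBound M
  | .seq P Q => P.timeBound M + Q.timeBound M
  | .ite b P Q => 1 + b.costBound M + (P.timeBound M + Q.timeBound M)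
  | .loop b P => M * (1 + b.costBound M + P.timeBound M) + (1 + b.costBound M)

/-- Replacing bit lengths by the numbers themselves is crude, but harmless here because all numbers
that occur are polynomially bounded. -/
lemma size_le_of_le {a b : ℕ} (h : a ≤ b) : Nat.size a ≤ b :=
  Nat.size_le.mpr (h.trans_lt Nat.lt_two_pow_self)

lemma Term.eval_le {M : ℕ} {s : State} (h : s.Bdd M) (e : Term) : e.eval s ≤ e.valBound M := by
  induction e with
  | const k => exact le_rfl
  | reg r => exact h.1 r
  | get a i _ => exact h.2 a _
  | add e f he hf => exact Nat.add_le_add he hf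
  | sub e f he _ => exact (Nat.sub_le _ _).trans he
  | mul e f he hf => exact Nat.mul_le_mul he hf
  | div e f he _ => exact (Nat.div_le_self _ _).trans he

lemma Term.cost_le {M : ℕ} {s : State} (h : s.Bdd M) (e : Term) : e.cost s ≤ e.costBound M := by
  have hv := Term.eval_le h
  induction e with
  | const k => exact Nat.add_le_add le_rfl (size_le_of_le le_rfl)
  | reg r => exact Nat.add_le_add le_rfl (size_le_of_le (h.1 r))
  | get a i ih => exact Nat.add_le_add (Nat.add_le_add le_rfl (size_le_of_le (h.2 a _))) ih
  | add e f he hf =>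
    exact Nat.add_le_add (Nat.add_le_add (Nat.add_le_add le_rfl
      (size_le_of_le (hv (.add e f)))) he) hf
  | sub e f he hf =>
    exact Nat.add_le_add (Nat.add_le_add (Nat.add_le_add le_rfl
      (size_le_of_le (hv (.sub e f)))) he) hf
  | mul e f he hf =>
    exact Nat.add_le_add (Nat.add_le_add (Nat.add_le_add le_rfl
      (size_le_of_le (hv (.mul e f)))) he) hf
  | div e f he hf =>
    exact Nat.add_le_add (Nat.add_le_add (Nat.add_le_add le_rfl
      (size_le_of_le (hv (.div e f)))) he) hf

lemma Term.exists_valBound_eq (e : Term) :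
    ∃ p : Polynomial ℕ, ∀ M, e.valBound M = p.eval M := by
  induction e with
  | const k => exact ⟨Polynomial.C k, fun M => by simp [Term.valBound]⟩
  | reg r => exact ⟨Polynomial.X, fun M => by simp [Term.valBound]⟩
  | get a i _ => exact ⟨Polynomial.X, fun M => by simp [Term.valBound]⟩
  | add e f he hf =>
    obtain ⟨p, hp⟩ := he
    obtain ⟨q, hq⟩ := hf
    exact ⟨p + q, fun M => by simp [Term.valBound, hp, hq]⟩
  | sub e f he _ => exact he
  | mul e f he hf =>
    obtain ⟨p, hp⟩ := he
    obtain ⟨q, hq⟩ := hf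
    exact ⟨p * q, fun M => by simp [Term.valBound, hp, hq]⟩
  | div e f he _ => exact he

lemma Term.exists_costBound_eq (e : Term) :
    ∃ p : Polynomial ℕ, ∀ M, e.costBound M = p.eval M := by
  induction e with
  | const k => exact ⟨1 + Polynomial.C k, fun M => by simp [Term.costBound]⟩
  | reg r => exact ⟨1 + Polynomial.X, fun M => by simp [Term.costBound]⟩
  | get a i hi =>
    obtain ⟨p, hp⟩ := hi
    exact ⟨1 + Polynomial.X + p, fun M => by simp [Term.costBound, hp]⟩
  | add e f he hf =>
    obtain ⟨p, hp⟩ := he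
    obtain ⟨q, hq⟩ := hf
    obtain ⟨v, hv⟩ := e.exists_valBound_eq
    obtain ⟨w, hw⟩ := f.exists_valBound_eq
    exact ⟨1 + (v + w) + p + q, fun M => by simp [Term.costBound, hp, hq, hv, hw]⟩
  | mul e f he hf =>
    obtain ⟨p, hp⟩ := he
    obtain ⟨q, hq⟩ := hf
    obtain ⟨v, hv⟩ := e.exists_valBound_eq
    obtain ⟨w, hw⟩ := f.exists_valBound_eq
    exact ⟨1 + v * w + p + q, fun M => by simp [Term.costBound, hp, hq, hv, hw]⟩
  | sub e f he hf | div e f he hf =>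
    obtain ⟨p, hp⟩ := he
    obtain ⟨q, hq⟩ := hf
    obtain ⟨v, hv⟩ := e.exists_valBound_eq
    exact ⟨1 + v + p + q, fun M => by simp [Term.costBound, hp, hq, hv]⟩

/-- The bound for a conditional adds both branches instead of taking their maximum, and that for a
loop multiplies by `M`; so the bounds stay polynomial. -/
lemma Prog.exists_timeBound_eq (P : Prog) :
    ∃ p : Polynomial ℕ, ∀ M, P.timeBound M = p.eval M := by
  induction P with
  | skip => exact ⟨1, fun M => by simp [Prog.timeBound]⟩
  | assign r e =>
    obtain ⟨p, hp⟩ := e.exists_costBound_eq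
    exact ⟨1 + p, fun M => by simp [Prog.timeBound, hp]⟩
  | store a i e =>
    obtain ⟨p, hp⟩ := i.exists_costBound_eq
    obtain ⟨q, hq⟩ := e.exists_costBound_eq
    exact ⟨1 + p + q, fun M => by simp [Prog.timeBound, hp, hq]⟩
  | seq P Q hP hQ =>
    obtain ⟨p, hp⟩ := hP
    obtain ⟨q, hq⟩ := hQ
    exact ⟨p + q, fun M => by simp [Prog.timeBound, hp, hq]⟩
  | ite b P Q hP hQ =>
    obtain ⟨p, hp⟩ := hP
    obtain ⟨q, hq⟩ := hQ
    obtain ⟨r, hr⟩ := b.exists_costBound_eq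
    exact ⟨1 + r + (p + q), fun M => by simp [Prog.timeBound, hp, hq, hr]⟩
  | loop b P hP =>
    obtain ⟨p, hp⟩ := hP
    obtain ⟨r, hr⟩ := b.exists_costBound_eq
    exact ⟨Polynomial.X * (1 + r + p) + (1 + r), fun M => by simp [Prog.timeBound, hp, hr]⟩

/-! ### Rules for composing bounded runs -/

/-- `Runs M P s s'`: the program `P` takes `s` to `s'` within the time bound that belongs to the
bound `M` on memory contents, and the contents of `s'` respect that bound. -/
def Runs (M : ℕ) (P : Prog) (s s' : State) : Prop :=
  s'.Bdd M ∧ ∃ t ≤ P.timeBound M, Exec P s s' t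

variable {M : ℕ} {s s' s'' : State} {P Q : Prog} {b e i : Term}

lemma Runs.bdd (h : Runs M P s s') : s'.Bdd M := h.1

lemma Runs.skip (hs : s.Bdd M) : Runs M .skip s s := ⟨hs, 1, le_rfl, .skip s⟩

lemma Runs.assign (hs : s.Bdd M) (r : ℕ) (he : e.eval s ≤ M) :
    Runs M (.assign r e) s (s.setReg r (e.eval s)) :=
  ⟨hs.setReg he, _, Nat.add_le_add le_rfl (e.cost_le hs), .assign s r e⟩

lemma Runs.store (hs : s.Bdd M) (a : ℕ) (he : e.eval s ≤ M) :
    Runs M (.store a i e) s (s.setArr a (i.eval s) (e.eval s)) :=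
  ⟨hs.setArr he, _, Nat.add_le_add (Nat.add_le_add le_rfl (i.cost_le hs)) (e.cost_le hs),
    .store s a i e⟩

lemma Runs.seq (hP : Runs M P s s') (hQ : Runs M Q s' s'') : Runs M (.seq P Q) s s'' := by
  obtain ⟨_, t, ht, h⟩ := hP
  obtain ⟨hb, t', ht', h'⟩ := hQ
  exact ⟨hb, _, Nat.add_le_add ht ht', h.seq h'⟩

lemma Runs.ite_true (hs : s.Bdd M) (hb : b.eval s ≠ 0) (hP : Runs M P s s') :
    Runs M (.ite b P Q) s s' := by
  obtain ⟨hb', t, ht, h⟩ := hP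
  exact ⟨hb', _, Nat.add_le_add (Nat.add_le_add le_rfl (b.cost_le hs))
    (ht.trans (Nat.le_add_right _ _)), .ite_true hb h⟩

lemma Runs.ite_false (hs : s.Bdd M) (hb : b.eval s = 0) (hQ : Runs M Q s s') :
    Runs M (.ite b P Q) s s' := by
  obtain ⟨hb', t, ht, h⟩ := hQ
  exact ⟨hb', _, Nat.add_le_add (Nat.add_le_add le_rfl (b.cost_le hs))
    (ht.trans (Nat.le_add_left _ _)), .ite_false hb h⟩

/-- The rule for loops: an invariant `I`, and a measure that decreases in each round. -/
lemma Runs.loop (I : State → Prop) (μ : State → ℕ) (hs : s.Bdd M) (hI : I s) (hμ : μ s ≤ M)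
    (step : ∀ u, u.Bdd M → I u → b.eval u ≠ 0 → ∃ u', Runs M P u u' ∧ I u' ∧ μ u' < μ u) :
    ∃ s', Runs M (.loop b P) s s' ∧ I s' ∧ b.eval s' = 0 := by
  -- The number of rounds is bounded by a variable `d` above the measure, so that the induction can
  -- lower it while `M` stays fixed.
  suffices H : ∀ (d : ℕ) (u : State), u.Bdd M → I u → μ u ≤ d → ∃ u', u'.Bdd M ∧
      (∃ t ≤ d * (1 + b.costBound M + P.timeBound M) + (1 + b.costBound M),
        Exec (.loop b P) u u' t) ∧ I u' ∧ b.eval u' = 0 by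
    obtain ⟨s', hb, ⟨t, ht, h⟩, hI', h0⟩ := H _ s hs hI hμ
    exact ⟨s', ⟨hb, t, ht, h⟩, hI', h0⟩
  intro d
  induction d with
  | zero =>
    intro u hu hIu hμu
    by_cases hb : b.eval u = 0
    · exact ⟨u, hu, ⟨_, by have := b.cost_le hu; omega, .loop_false hb⟩, hIu, hb⟩
    · obtain ⟨u', _, _, h⟩ := step u hu hIu hb
      omega
  | succ d ih =>
    intro u hu hIu hμu
    by_cases hb : b.eval u = 0
    · exact ⟨u, hu, ⟨_, by have := b.cost_le hu; nlinarith, .loop_false hb⟩, hIu, hb⟩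
    · obtain ⟨u', ⟨hu', t, ht, h⟩, hIu', hlt⟩ := step u hu hIu hb
      obtain ⟨u'', hu'', ⟨t', ht', h'⟩, hI'', h0⟩ := ih u' hu' hIu' (by omega)
      refine ⟨u'', hu'', ⟨_, ?_, .loop_true hb h h'⟩, hI'', h0⟩
      have := b.cost_le hu
      rw [Nat.succ_mul]
      omega

/-! ### Frame conditions and the summation loop -/

/-- `Agree q s s'`: the memory states differ at most in registers from number `q` on. -/
def Agree (q : ℕ) (s s' : State) : Prop := s'.arr = s.arr ∧ ∀ r < q, s'.reg r = s.reg r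

lemma Agree.refl (q : ℕ) (s : State) : Agree q s s := ⟨rfl, fun _ _ => rfl⟩

lemma Agree.trans {q : ℕ} (h : Agree q s s') (h' : Agree q s' s'') : Agree q s s'' :=
  ⟨h'.1.trans h.1, fun r hr => (h'.2 r hr).trans (h.2 r hr)⟩

lemma Agree.mono {p q : ℕ} (h : Agree q s s') (hpq : p ≤ q) : Agree p s s' :=
  ⟨h.1, fun r hr => h.2 r (hr.trans_le hpq)⟩

lemma Agree.setReg {q : ℕ} (h : Agree q s s') {r : ℕ} (hr : q ≤ r) (v : ℕ) :
    Agree q s (s'.setReg r v) := by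
  refine ⟨h.1, fun r' hr' => ?_⟩
  rw [State.setReg_reg, if_neg (by omega), h.2 r' hr']

/-- Sum, in register `q`, the values that `body` leaves in register `q + 2`, while register
`q + 1` runs through the numbers below `bound`. -/
def sumLoop (q : ℕ) (bound : Term) (body : Prog) : Prog :=
  .seq (.assign q (.const 0)) <| .seq (.assign (q + 1) (.const 0)) <|
    .loop (.sub bound (.reg (q + 1))) <|
      .seq body <| .seq (.assign q (.add (.reg q) (.reg (q + 2))))
        (.assign (q + 1) (.add (.reg (q + 1)) (.const 1)))

/-- The accumulator `q` and the counter `q + 1` survive because `body` changes only registers from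
`q + 2` on. The assumptions range over all states that agree with `s` below `q`, since `bound` and
`body` are executed again in every round. -/
lemma runs_sumLoop {q n : ℕ} {bound : Term} {body : Prog} (g : ℕ → ℕ) (hs : s.Bdd M)
    (hbound : ∀ u, Agree q s u → bound.eval u = n) (hn : n ≤ M)
    (hg : ∑ x ∈ Finset.range n, g x ≤ M)
    (hbody : ∀ u, u.Bdd M → Agree q s u → u.reg (q + 1) < n →
      ∃ u', Runs M body u u' ∧ Agree (q + 2) u u' ∧ u'.reg (q + 2) = g (u.reg (q + 1))) :
    ∃ s', Runs M (sumLoop q bound body) s s' ∧ Agree q s s' ∧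
      s'.reg q = ∑ x ∈ Finset.range n, g x := by
  have h1 : Runs M (.assign q (.const 0)) s (s.setReg q 0) := Runs.assign hs q (Nat.zero_le M)
  have h2 : Runs M (.assign (q + 1) (.const 0)) (s.setReg q 0)
      ((s.setReg q 0).setReg (q + 1) 0) := Runs.assign h1.bdd _ (Nat.zero_le M)
  obtain ⟨s', h3, ⟨hA, hle, hsum⟩, h0⟩ := Runs.loop (b := .sub bound (.reg (q + 1)))
    (P := .seq body <| .seq (.assign q (.add (.reg q) (.reg (q + 2))))
        (.assign (q + 1) (.add (.reg (q + 1)) (.const 1))))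
    (fun u => Agree q s u ∧ u.reg (q + 1) ≤ n ∧
      u.reg q = ∑ x ∈ Finset.range (u.reg (q + 1)), g x)
    (fun u => n - u.reg (q + 1)) h2.bdd
    ⟨((Agree.refl q s).setReg le_rfl 0).setReg (Nat.le_succ q) 0,
      by simp [State.setReg_reg], by simp [State.setReg_reg]⟩ ((Nat.sub_le _ _).trans hn) (by
      rintro u hu ⟨hA, hle, hsum⟩ hb
      have hlt : u.reg (q + 1) < n := by
        simp only [Term.eval, hbound u hA] at hb
        omega
      obtain ⟨u', hr, hA', hv⟩ := hbody u hu hA hlt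
      have e1 : u'.reg q = u.reg q := hA'.2 q (by omega)
      have e2 : u'.reg (q + 1) = u.reg (q + 1) := hA'.2 (q + 1) (by omega)
      have hsum' : u'.reg q + u'.reg (q + 2) = ∑ x ∈ Finset.range (u.reg (q + 1) + 1), g x := by
        rw [e1, hv, hsum, Finset.sum_range_succ]
      have hle' : u'.reg q + u'.reg (q + 2) ≤ M := by
        rw [hsum']
        exact (Finset.sum_le_sum_of_subset (Finset.range_mono hlt)).trans hg
      have r1 := Runs.assign (e := .add (.reg q) (.reg (q + 2))) hr.bdd q hle'
      have r2 := Runs.assign (e := .add (.reg (q + 1)) (.const 1)) r1.bdd (q + 1) (by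
        simp only [Term.eval, State.setReg_reg, Nat.succ_ne_self, if_false, e2]
        omega)
      refine ⟨_, hr.seq (r1.seq r2), ⟨?_, ?_, ?_⟩, ?_⟩
      · exact ((hA.trans (hA'.mono (by omega))).setReg le_rfl _).setReg (Nat.le_succ q) _
      · simp [Term.eval, State.setReg_reg, e2]
        omega
      · simp [Term.eval, State.setReg_reg, e2, hsum']
      · simp [Term.eval, State.setReg_reg, e2]
        omega)
  refine ⟨s', h1.seq (h2.seq h3), hA, ?_⟩
  simp only [Term.eval, hbound s' hA] at h0
  rw [hsum, show s'.reg (q + 1) = n by omega]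

end RAM

/-! ### An auction for the assignment problem -/

/-- The invariant of the auction with costs `(m + 1) * W i j` and bid increment `1`. Column `j` is
owned by row `own j - 1`, or by nobody if `own j = 0`; row `cur - 1` is the next bidder, and the
rows `i < rows` other than the bidder are the owners. -/
structure AuctionInv (m : ℕ) (W : ℕ → ℕ → ℕ) (B rows cur : ℕ) (own price : ℕ → ℕ) : Prop where
  rows_le : rows ≤ m
  cur_pos : 0 < cur
  cur_le : cur ≤ rows + 1
  own_le : ∀ j < m, own j ≤ m
  own_le_rows : ∀ j < m, own j ≤ rows + 1
  own_ne_cur : ∀ j < m, own j ≠ cur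
  own_inj : ∀ j < m, ∀ j' < m, own j ≠ 0 → own j = own j' → j = j'
  card_owned : ((Finset.range m).filter fun j => own j ≠ 0).card = rows
  price_eq_zero : ∀ j < m, own j = 0 → price j = 0
  price_le : ∀ j < m, price j ≤ (m + 1) * B + 1
  slack : ∀ j < m, own j ≠ 0 → ∀ j' < m,
    (m + 1) * W (own j - 1) j + price j ≤ (m + 1) * W (own j - 1) j' + price j' + 1

namespace AuctionInv

variable {m B rows cur : ℕ} {W : ℕ → ℕ → ℕ} {own price : ℕ → ℕ}

lemma start (m : ℕ) (W : ℕ → ℕ → ℕ) (B : ℕ) : AuctionInv m W B 0 1 (fun _ => 0) fun _ => 0 where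
  rows_le := Nat.zero_le m
  cur_pos := Nat.one_pos
  cur_le := le_rfl
  own_le := by simp
  own_le_rows := by simp
  own_ne_cur := by simp
  own_inj := by simp
  card_owned := by simp
  price_eq_zero := by simp
  price_le := by simp
  slack := by simp

/-- Supplies the column of price 0 against which every bid is compared. -/
lemma exists_unowned (h : AuctionInv m W B rows cur own price) (hr : rows < m) :
    ∃ j < m, own j = 0 := by
  by_contra! hne
  have := h.card_owned
  rw [Finset.filter_true_of_mem fun j hj => hne j (Finset.mem_range.mp hj),
    Finset.card_range] at this
  omega

/-- The sum of prices is the potential of the auction: each bid raises it by 1, so this bounds the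
number of bids. -/
lemma sum_price_le (h : AuctionInv m W B rows cur own price) :
    ∑ j ∈ Finset.range m, price j ≤ m * ((m + 1) * B + 1) := by
  simpa using Finset.sum_le_card_nsmul (Finset.range m) price _
    fun j hj => h.price_le j (Finset.mem_range.mp hj)

/-- The price increment uses up the slack 1 of the new owner and only relaxes the conditions of the
other owners. A displaced owner bids next; if there is none, a new row enters, and the shift by one
in the row numbers makes it `rows + 2`. -/
lemma bid (h : AuctionInv m W B rows cur own price) (hr : rows < m)
    (hB : ∀ i < m, ∀ j < m, W i j ≤ B) {j : ℕ} (hj : j < m)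
    (hmin : ∀ j' < m, (m + 1) * W (cur - 1) j + price j ≤ (m + 1) * W (cur - 1) j' + price j') :
    AuctionInv m W B (if own j = 0 then rows + 1 else rows)
      (if own j = 0 then rows + 2 else own j) (Function.update own j cur)
      (Function.update price j (price j + 1)) := by
  have hcm : cur ≤ m := h.cur_le.trans hr
  have hc0 := h.cur_pos
  have hc1 := h.cur_le
  have hfilter : (Finset.range m).filter (fun i => Function.update own j cur i ≠ 0) =
      insert j ((Finset.range m).filter fun i => own i ≠ 0) := by
    ext i
    simp only [Finset.mem_filter, Finset.mem_insert, Finset.mem_range, Function.update_apply]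
    split_ifs with hi
    · subst hi; simp [hj, hc0.ne']
    · simp [hi]
  refine ⟨?_, ?_, ?_, ?_, ?_, ?_, ?_, ?_, ?_, ?_, ?_⟩
  · have := h.rows_le
    split_ifs <;> omega
  · split_ifs <;> omega
  · have := h.own_le_rows j hj
    split_ifs <;> omega
  · intro i hi
    rw [Function.update_apply]
    have := h.own_le i hi
    split_ifs <;> omega
  · intro i hi
    rw [Function.update_apply]
    have := h.own_le_rows i hi
    split_ifs <;> omega
  · intro i hi
    rw [Function.update_apply]
    have h1 := h.own_le_rows i hi
    have h2 := h.own_ne_cur j hj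
    have h3 := h.own_inj i hi j hj
    split_ifs with h4 h5 h5
    · omega
    · omega
    · omega
    · intro he
      exact h4 (h3 (by omega) he)
  · intro i hi i' hi'
    rw [Function.update_apply, Function.update_apply]
    have h1 := h.own_ne_cur i hi
    have h2 := h.own_ne_cur i' hi'
    have h3 := h.own_inj i hi i' hi'
    split_ifs with h4 h5 h5
    · intros; omega
    · intro _ he; omega
    · intro _ he; omega
    · exact h3
  · rw [hfilter]
    have := h.card_owned
    split_ifs with h0
    · rw [Finset.card_insert_of_notMem (by simp [h0]), this]
    · rw [Finset.insert_eq_of_mem (by simp [hj, h0]), this]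
  · intro i hi
    rw [Function.update_apply, Function.update_apply]
    split_ifs with h4
    · intro; omega
    · exact h.price_eq_zero i hi
  · intro i hi
    rw [Function.update_apply]
    split_ifs with h4
    -- An unowned column would cost the bidder at most `(m + 1) * B`. The chosen column is no worse,
    -- so its old price obeys the same bound.
    · obtain ⟨j₀, hj₀, hz⟩ := h.exists_unowned hr
      have h1 := hmin j₀ hj₀
      rw [h.price_eq_zero j₀ hj₀ hz] at h1
      have h2 := Nat.mul_le_mul_left (m + 1) (hB (cur - 1) (by omega) j₀ hj₀)
      omega
    · exact h.price_le i hi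
  · intro i hi
    rw [Function.update_apply, Function.update_apply]
    intro h0 i' hi'
    rw [Function.update_apply]
    by_cases h4 : i = j
    · subst h4
      simp only [if_true]
      have := hmin i' hi'
      split_ifs with h5
      · subst h5; omega
      · omega
    · simp only [if_neg h4] at h0 ⊢
      have := h.slack i hi h0 i' hi'
      split_ifs with h5
      · subst h5; omega
      · omega

lemma sum_update_price {j : ℕ} (hj : j < m) :
    ∑ i ∈ Finset.range m, Function.update price j (price j + 1) i =
      ∑ i ∈ Finset.range m, price i + 1 := by
  rw [Finset.sum_update_of_mem (Finset.mem_range.mpr hj),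
    ← Finset.sum_sdiff (Finset.singleton_subset_iff.mpr (Finset.mem_range.mpr hj)),
    Finset.sum_singleton]
  ring

/-- When all rows own a column, the assignment is one of minimum cost. -/
lemma optimal (h : AuctionInv m W B m cur own price) :
    ∃ σ : Equiv.Perm (Fin m), (∀ j : Fin m, own j = σ j + 1) ∧ ∀ τ : Equiv.Perm (Fin m),
      ∑ j, W (σ j) j ≤ ∑ j, W (τ j) j := by
  have hne : ∀ j < m, own j ≠ 0 := by
    have hc := h.card_owned
    have := Finset.eq_of_subset_of_card_le (Finset.filter_subset (fun j => own j ≠ 0)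
      (Finset.range m)) (by rw [hc, Finset.card_range])
    intro j hj
    rw [← Finset.mem_range, ← this] at hj
    exact (Finset.mem_filter.mp hj).2
  have hlt : ∀ j : Fin m, own j - 1 < m := fun j => by
    have h1 := h.own_le j j.2
    have h2 := hne j j.2
    omega
  have hinj : Function.Injective fun j : Fin m => (⟨own j - 1, hlt j⟩ : Fin m) := by
    intro j j' he
    have h1 := hne j j.2
    have h2 := hne j' j'.2
    have h3 : own j - 1 = own j' - 1 := congrArg Fin.val he
    exact Fin.ext (h.own_inj j j.2 j' j'.2 h1 (by omega))
  let σ : Equiv.Perm (Fin m) := Equiv.ofBijective _ (Finite.injective_iff_bijective.mp hinj)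
  have hσ : ∀ j, ((σ j : Fin m) : ℕ) = own j - 1 := fun j => rfl
  refine ⟨σ, fun j => by have := hne j j.2; rw [hσ]; omega, fun τ => ?_⟩
  -- The column `τ.symm (σ j)` is the one that `τ` gives to the owner of `j`. Summed over `j`, the
  -- prices on the two sides cancel.
  have hs : ∀ j : Fin m, (m + 1) * W (σ j) j + price j ≤
      (m + 1) * W (σ j) (τ.symm (σ j)) + price (τ.symm (σ j)) + 1 := by
    intro j
    rw [hσ]
    exact h.slack j j.2 (hne j j.2) _ (τ.symm (σ j)).2
  have hsum := Finset.sum_le_sum fun j (_ : j ∈ Finset.univ) => hs j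
  rw [Finset.sum_add_distrib, Finset.sum_add_distrib, Finset.sum_add_distrib, ← Finset.mul_sum,
    ← Finset.mul_sum] at hsum
  have e1 : ∑ j : Fin m, price (τ.symm (σ j)) = ∑ j : Fin m, price j :=
    Equiv.sum_comp (σ.trans τ.symm) fun j : Fin m => price j
  have e2 : ∑ j : Fin m, W (σ j) (τ.symm (σ j)) = ∑ j : Fin m, W (τ j) j := by
    rw [← Equiv.sum_comp (σ.trans τ.symm) fun j : Fin m => W (τ j) j]
    simp
  rw [e1, e2] at hsum
  simp only [Finset.sum_const, Finset.card_univ, Fintype.card_fin, smul_eq_mul, mul_one] at hsum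
  -- A cheaper assignment would save at least `m + 1` after scaling, but the total slack is only
  -- `m`.
  by_contra! hcon
  have := Nat.mul_le_mul_left (m + 1) hcon
  rw [Nat.mul_succ] at this
  omega

end AuctionInv

/-! ### The program -/

/-- The number of indices `t < N` with `f (off + t) = c` whose remainder modulo `m` is at most
`x`. -/
def countUpTo (f : ℕ → ℕ) (m off N c x : ℕ) : ℕ :=
  ∑ t ∈ Finset.range N, if f (off + t) = c ∧ t % m ≤ x then 1 else 0

/-- The contribution of position `x` to `matchWeight`. -/
def prefixWeight (f : ℕ → ℕ) (m n k i j x : ℕ) : ℕ :=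
  (k * countUpTo f m 3 (n * m) i x - n * countUpTo f m (3 + n * m) (k * m) j x) +
    (n * countUpTo f m (3 + n * m) (k * m) j x - k * countUpTo f m 3 (n * m) i x)

/-- `n * k` times the earth mover's distance of the frequency vectors of candidate `i` of the first
and candidate `j` of the second election, for a pair of elections given by the input `f`. -/
def matchWeight (f : ℕ → ℕ) (m n k i j : ℕ) : ℕ :=
  ∑ x ∈ Finset.range m, prefixWeight f m n k i j x

lemma countUpTo_le (f : ℕ → ℕ) (m off N c x : ℕ) : countUpTo f m off N c x ≤ N := by
  refine (Finset.sum_le_card_nsmul _ _ 1 fun t _ => ?_).trans (by simp)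
  split_ifs <;> simp

lemma prefixWeight_le (f : ℕ → ℕ) (m n k i j x : ℕ) :
    prefixWeight f m n k i j x ≤ k * (n * m) + n * (k * m) := by
  have h1 := Nat.mul_le_mul_left k (countUpTo_le f m 3 (n * m) i x)
  have h2 := Nat.mul_le_mul_left n (countUpTo_le f m (3 + n * m) (k * m) j x)
  rw [prefixWeight]
  omega

lemma matchWeight_le (f : ℕ → ℕ) (m n k i j : ℕ) :
    matchWeight f m n k i j ≤ m * (k * (n * m) + n * (k * m)) := by
  simpa [matchWeight] using Finset.sum_le_card_nsmul (Finset.range m) _ _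
    fun x _ => prefixWeight_le f m n k i j x

namespace RAM

/-- `|e - f|` as an expression. -/
def Term.absDiff (e f : Term) : Term := .add (.sub e f) (.sub f e)

/-- Compute `countUpTo` in register `q`. -/
def countLoop (q : ℕ) (off N c x : Term) : Prog :=
  sumLoop q N <| .assign (q + 2) <|
    .mul (.sub (.const 1) (.absDiff (.get 0 (.add off (.reg (q + 1)))) c))
      (.sub (.const 1)
        (.sub (.sub (.reg (q + 1)) (.mul (.reg 2) (.div (.reg (q + 1)) (.reg 2)))) x))

/-- Compute `matchWeight` in register `q`. -/
def weightLoop (q : ℕ) (row col : Term) : Prog :=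
  sumLoop q (.reg 2) <|
    .seq (countLoop (q + 2) (.const 3) (.mul (.reg 3) (.reg 2)) row (.reg (q + 1))) <|
    .seq (countLoop (q + 3) (.add (.const 3) (.mul (.reg 3) (.reg 2))) (.mul (.reg 4) (.reg 2))
      col (.reg (q + 1))) <|
    .assign (q + 2) (.absDiff (.mul (.reg 4) (.reg (q + 2))) (.mul (.reg 3) (.reg (q + 3))))

/-- Find, in register `8`, the best column for the bidder. -/
def bestColumn : Prog :=
  .seq (.assign 9 (.const 0)) <| .loop (.sub (.reg 2) (.reg 9)) <|
    .seq (weightLoop 10 (.sub (.reg 6) (.const 1)) (.reg 9)) <|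
    .seq (.assign 10 (.add (.mul (.add (.reg 2) (.const 1)) (.reg 10)) (.get 2 (.reg 9)))) <|
    .seq (.ite (.add (.sub (.const 1) (.reg 9)) (.sub (.reg 7) (.reg 10)))
      (.seq (.assign 7 (.reg 10)) (.assign 8 (.reg 9))) .skip) <|
    .assign 9 (.add (.reg 9) (.const 1))

/-- The bidder gets the best column, and its price goes up. -/
def placeBid : Prog :=
  .seq (.store 2 (.reg 8) (.add (.get 2 (.reg 8)) (.const 1))) <|
    .seq (.assign 9 (.get 1 (.reg 8))) <| .seq (.store 1 (.reg 8) (.reg 6)) <|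
    .ite (.reg 9) (.assign 6 (.reg 9)) <|
    .seq (.assign 5 (.add (.reg 5) (.const 1))) (.assign 6 (.add (.reg 5) (.const 1)))

/-- Read the parameters of the input. -/
def readInput : Prog :=
  .seq (.assign 2 (.get 0 (.const 0))) <| .seq (.assign 3 (.get 0 (.const 1))) <|
    .seq (.assign 4 (.get 0 (.const 2))) <| .seq (.assign 5 (.const 0)) (.assign 6 (.const 1))

/-- Write the cost of the assignment to register `0` and the denominator to register `1`. -/
def writeOutput : Prog :=
  .seq (sumLoop 7 (.reg 2) (weightLoop 9 (.sub (.get 1 (.reg 8)) (.const 1)) (.reg 8))) <|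
    .seq (.assign 0 (.reg 7)) (.assign 1 (.mul (.reg 3) (.reg 4)))

/-- Compute the positionwise distance of two elections with at least one candidate. -/
def posDistMain : Prog :=
  .seq readInput <| .seq (.loop (.sub (.reg 2) (.reg 5)) (.seq bestColumn placeBid)) writeOutput

/-- Compute the positionwise distance of two elections. -/
def posDistProg : Prog :=
  .ite (.get 0 (.const 0)) posDistMain (.seq (.assign 0 (.const 0)) (.assign 1 (.const 1)))

/-! ### Correctness of the counting and weight loops -/

variable {M : ℕ} {s : State}

lemma runs_countLoop {q m off N c x : ℕ} {offT NT cT xT : Term} (hq : 2 < q) (hs : s.Bdd M)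
    (hm : s.reg 2 = m) (hoff : ∀ u, Agree q s u → offT.eval u = off)
    (hN : ∀ u, Agree q s u → NT.eval u = N) (hc : ∀ u, Agree q s u → cT.eval u = c)
    (hx : ∀ u, Agree q s u → xT.eval u = x) (h1 : 1 ≤ M) (hNM : N ≤ M) :
    ∃ s', Runs M (countLoop q offT NT cT xT) s s' ∧ Agree q s s' ∧
      s'.reg q = countUpTo (s.arr 0) m off N c x := by
  refine runs_sumLoop _ hs hN hNM ((countUpTo_le _ _ _ _ _ _).trans hNM) fun u hu hA hlt => ?_
  -- Both factors are indicators written with truncated subtraction: `1 - d` is 1 if `d = 0`, and 0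
  -- otherwise. The remainder modulo `m` is obtained from the quotient.
  have hval : Term.eval u (.mul
      (.sub (.const 1) (.absDiff (.get 0 (.add offT (.reg (q + 1)))) cT))
      (.sub (.const 1)
        (.sub (.sub (.reg (q + 1)) (.mul (.reg 2) (.div (.reg (q + 1)) (.reg 2)))) xT))) =
      if s.arr 0 (off + u.reg (q + 1)) = c ∧ u.reg (q + 1) % m ≤ x then 1 else 0 := by
    simp only [Term.eval, Term.absDiff, hoff u hA, hc u hA, hx u hA, hA.1, hA.2 2 hq, hm,
      ← Nat.mod_eq_sub_mul_div]
    split_ifs with h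
    · rw [h.1]
      have : u.reg (q + 1) % m - x = 0 := by omega
      simp [this]
    · rw [not_and_or] at h
      rcases h with h | h
      · rw [Nat.mul_eq_zero]
        left
        omega
      · rw [Nat.mul_eq_zero]
        right
        omega
  refine ⟨_, Runs.assign hu (q + 2) ?_, (Agree.refl _ u).setReg le_rfl _, ?_⟩
  · rw [hval]
    split_ifs <;> omega
  · rw [State.setReg_reg, if_pos rfl, hval]

/-- The memory holds the input `f` in array `0`, and the parameters of the input. -/
structure HasInput (f : ℕ → ℕ) (m n k : ℕ) (s : State) : Prop where
  arr_zero : s.arr 0 = f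
  reg_two : s.reg 2 = m
  reg_three : s.reg 3 = n
  reg_four : s.reg 4 = k

lemma HasInput.of_agree {f : ℕ → ℕ} {m n k q : ℕ} {u : State} (h : HasInput f m n k s)
    (hq : 4 < q) (hA : Agree q s u) : HasInput f m n k u :=
  ⟨by rw [hA.1, h.arr_zero], by rw [hA.2 2 (by omega), h.reg_two],
    by rw [hA.2 3 (by omega), h.reg_three], by rw [hA.2 4 hq, h.reg_four]⟩

/-- `M` bounds all numbers that the program computes. -/
structure Large (m n k M : ℕ) : Prop where
  succ_le : m + 1 ≤ M
  mul_le : n * k ≤ M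
  left_le : n * m ≤ M
  right_le : k * m ≤ M
  prefix_le : k * (n * m) + n * (k * m) ≤ M
  sum_le : m * (m * (k * (n * m) + n * (k * m))) ≤ M
  bid_le : 2 * ((m + 1) * (m * (k * (n * m) + n * (k * m)))) + 2 ≤ M
  rounds_le : m * ((m + 1) * (m * (k * (n * m) + n * (k * m))) + 1) ≤ M

variable {f : ℕ → ℕ} {m n k : ℕ}

lemma Large.one_le (h : Large m n k M) : 1 ≤ M := (Nat.le_add_left 1 m).trans h.succ_le

lemma Large.le (h : Large m n k M) : m ≤ M := (Nat.le_add_right m 1).trans h.succ_le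

lemma Large.weight_le (h : Large m n k M) (i j : ℕ) : matchWeight f m n k i j ≤ M := by
  have h1 := matchWeight_le f m n k i j
  have h2 := Nat.le_mul_of_pos_left (m * (k * (n * m) + n * (k * m))) (Nat.succ_pos m)
  have h3 := h.bid_le
  simp only [Nat.succ_eq_add_one] at h2
  omega

lemma runs_weightLoop {q i j : ℕ} {row col : Term} (hq : 4 < q) (hs : s.Bdd M)
    (hM : Large m n k M) (hI : HasInput f m n k s)
    (hrow : ∀ u, Agree q s u → row.eval u = i) (hcol : ∀ u, Agree q s u → col.eval u = j) :
    ∃ s', Runs M (weightLoop q row col) s s' ∧ Agree q s s' ∧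
      s'.reg q = matchWeight f m n k i j := by
  refine runs_sumLoop _ hs (fun u hA => (hI.of_agree hq hA).reg_two) hM.le
    (hM.weight_le i j) fun u hu hA _ => ?_
  have hIu := hI.of_agree hq hA
  obtain ⟨u₁, hr₁, hA₁, hv₁⟩ := runs_countLoop (q := q + 2) (m := m) (off := 3) (N := n * m)
    (c := i) (x := u.reg (q + 1)) (offT := .const 3) (NT := .mul (.reg 3) (.reg 2)) (cT := row)
    (xT := .reg (q + 1)) (by omega) hu hIu.reg_two (fun _ _ => rfl)
    (fun v hv => by
      have := hIu.of_agree (by omega) hv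
      rw [Term.eval, Term.eval, Term.eval, this.reg_two, this.reg_three])
    (fun v hv => hrow v (hA.trans (hv.mono (by omega)))) (fun v hv => hv.2 _ (by omega))
    hM.one_le hM.left_le
  have hIu₁ := hIu.of_agree (by omega) hA₁
  -- The second count works from register `q + 3` on, so the first count in `q + 2` is preserved.
  obtain ⟨u₂, hr₂, hA₂, hv₂⟩ := runs_countLoop (q := q + 3) (m := m) (off := 3 + n * m)
    (N := k * m) (c := j) (x := u.reg (q + 1))
    (offT := .add (.const 3) (.mul (.reg 3) (.reg 2))) (NT := .mul (.reg 4) (.reg 2)) (cT := col)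
    (xT := .reg (q + 1)) (by omega) hr₁.bdd hIu₁.reg_two
    (fun v hv => by
      have := hIu₁.of_agree (by omega) hv
      simp only [Term.eval, this.reg_two, this.reg_three])
    (fun v hv => by
      have := hIu₁.of_agree (by omega) hv
      simp only [Term.eval, this.reg_two, this.reg_four])
    (fun v hv => hcol v ((hA.trans (hA₁.mono (by omega))).trans (hv.mono (by omega))))
    (fun v hv => by rw [Term.eval, hv.2 _ (by omega), hA₁.2 _ (by omega)])
    hM.one_le hM.right_le
  have hIu₂ := hIu₁.of_agree (by omega) hA₂
  have hval : Term.eval u₂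
      (.absDiff (.mul (.reg 4) (.reg (q + 2))) (.mul (.reg 3) (.reg (q + 3)))) =
      prefixWeight f m n k i j (u.reg (q + 1)) := by
    simp only [Term.eval, Term.absDiff, hIu₂.reg_three, hIu₂.reg_four, hv₂,
      hA₂.2 (q + 2) (by omega), hv₁, prefixWeight, hIu.arr_zero, hIu₁.arr_zero]
  refine ⟨_, hr₁.seq (hr₂.seq (Runs.assign hr₂.bdd (q + 2) ?_)), ?_, ?_⟩
  · rw [hval]
    exact (prefixWeight_le _ _ _ _ _ _ _).trans hM.prefix_le
  · exact (hA₁.trans (hA₂.mono (by omega))).setReg le_rfl _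
  · rw [State.setReg_reg, if_pos rfl, hval]

end RAM

/-! ### Correctness of the auction program -/

namespace RAM

variable {M : ℕ} {s : State} {f : ℕ → ℕ} {m n k : ℕ}

lemma runs_bestColumn (hs : s.Bdd M) (hM : Large m n k M) (hI : HasInput f m n k s) (hm : 0 < m)
    (hp : ∀ j < m, s.arr 2 j ≤ (m + 1) * (m * (k * (n * m) + n * (k * m))) + 1) :
    ∃ s', Runs M bestColumn s s' ∧ Agree 7 s s' ∧ s'.reg 8 < m ∧ ∀ j < m,
      (m + 1) * matchWeight f m n k (s.reg 6 - 1) (s'.reg 8) + s.arr 2 (s'.reg 8) ≤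
        (m + 1) * matchWeight f m n k (s.reg 6 - 1) j + s.arr 2 j := by
  set val : ℕ → ℕ := fun j => (m + 1) * matchWeight f m n k (s.reg 6 - 1) j + s.arr 2 j with hval
  have hvalM : ∀ j < m, val j ≤ M := by
    intro j hj
    have h1 := hp j hj
    have h2 := Nat.mul_le_mul_left (m + 1) (matchWeight_le f m n k (s.reg 6 - 1) j)
    have h3 := hM.bid_le
    simp only [hval]
    omega
  have h1 : Runs M (.assign 9 (.const 0)) s (s.setReg 9 0) := Runs.assign hs 9 (Nat.zero_le M)
  obtain ⟨s', h2, ⟨hA, hle, hbest⟩, h0⟩ := Runs.loop (b := .sub (.reg 2) (.reg 9))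
    (P := .seq (weightLoop 10 (.sub (.reg 6) (.const 1)) (.reg 9)) <|
      .seq (.assign 10 (.add (.mul (.add (.reg 2) (.const 1)) (.reg 10)) (.get 2 (.reg 9)))) <|
      .seq (.ite (.add (.sub (.const 1) (.reg 9)) (.sub (.reg 7) (.reg 10)))
        (.seq (.assign 7 (.reg 10)) (.assign 8 (.reg 9))) .skip) <|
      .assign 9 (.add (.reg 9) (.const 1)))
    -- Before the first column has been examined, registers 7 and 8 may hold leftovers, so the
    -- invariant says nothing about them.
    (fun u => Agree 7 s u ∧ u.reg 9 ≤ m ∧ (u.reg 9 ≠ 0 →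
      u.reg 8 < m ∧ u.reg 7 = val (u.reg 8) ∧ ∀ j < u.reg 9, u.reg 7 ≤ val j))
    (fun u => m - u.reg 9) h1.bdd
    ⟨(Agree.refl 7 s).setReg (by omega) 0, by simp [State.setReg_reg], by simp [State.setReg_reg]⟩
    ((Nat.sub_le _ _).trans hM.le) (by
      rintro u hu ⟨hA, hle, hbest⟩ hb
      have hIu := hI.of_agree (by omega) hA
      have hlt : u.reg 9 < m := by
        simp only [Term.eval, hIu.reg_two] at hb
        omega
      obtain ⟨u₁, r₁, hA₁, hv₁⟩ := runs_weightLoop (q := 10) (i := s.reg 6 - 1) (j := u.reg 9)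
        (row := .sub (.reg 6) (.const 1)) (col := .reg 9) (by omega) hu hM hIu
        (fun v hv => by
          simp only [Term.eval, hv.2 6 (by omega), hA.2 6 (by omega)])
        (fun v hv => by simp only [Term.eval, hv.2 9 (by omega)])
      have hIu₁ := hIu.of_agree (by omega) hA₁
      have e9 : u₁.reg 9 = u.reg 9 := hA₁.2 9 (by omega)
      have e8 : u₁.reg 8 = u.reg 8 := hA₁.2 8 (by omega)
      have e7 : u₁.reg 7 = u.reg 7 := hA₁.2 7 (by omega)
      have hA₁' : Agree 7 s u₁ := hA.trans (hA₁.mono (by omega))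
      have hv : Term.eval u₁
          (.add (.mul (.add (.reg 2) (.const 1)) (.reg 10)) (.get 2 (.reg 9))) =
          val (u.reg 9) := by
        simp only [Term.eval, hIu₁.reg_two, hv₁, e9, hA₁'.1, hval]
      have r₂ := Runs.assign r₁.bdd 10 (hv.le.trans (hvalM _ hlt))
      rw [hv] at r₂
      set u₂ := u₁.setReg 10 (val (u.reg 9)) with hu₂
      have hA₂ : Agree 7 s u₂ := hA₁'.setReg (by omega) _
      have f9 : u₂.reg 9 = u.reg 9 := by simp [hu₂, State.setReg_reg, e9]
      have f8 : u₂.reg 8 = u.reg 8 := by simp [hu₂, State.setReg_reg, e8]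
      have f7 : u₂.reg 7 = u.reg 7 := by simp [hu₂, State.setReg_reg, e7]
      have f10 : u₂.reg 10 = val (u.reg 9) := by simp [hu₂, State.setReg_reg]
      obtain ⟨u₃, r₃, hA₃, g9, g8, g7, gle⟩ : ∃ u₃, Runs M
          (.ite (.add (.sub (.const 1) (.reg 9)) (.sub (.reg 7) (.reg 10)))
            (.seq (.assign 7 (.reg 10)) (.assign 8 (.reg 9))) .skip) u₂ u₃ ∧ Agree 7 s u₃ ∧
          u₃.reg 9 = u.reg 9 ∧ u₃.reg 8 < m ∧ u₃.reg 7 = val (u₃.reg 8) ∧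
          ∀ j < u.reg 9 + 1, u₃.reg 7 ≤ val j := by
        -- The test is nonzero for column 0, which is always accepted, and for a strictly better
        -- column.
        by_cases hc : Term.eval u₂ (.add (.sub (.const 1) (.reg 9)) (.sub (.reg 7) (.reg 10))) = 0
        · refine ⟨u₂, Runs.ite_false r₂.bdd hc (Runs.skip r₂.bdd), hA₂, f9, ?_⟩
          simp only [Term.eval, f9, f7, f10] at hc
          obtain ⟨b1, b2, b3⟩ := hbest (by omega)
          rw [f8, f7]
          refine ⟨b1, b2, fun j hj => ?_⟩
          rcases Nat.lt_succ_iff_lt_or_eq.mp hj with h | h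
          · exact b3 j h
          · subst h; omega
        · have q₁ := Runs.assign (e := .reg 10) r₂.bdd 7 (r₂.bdd.1 10)
          have q₂ := Runs.assign (e := .reg 9) q₁.bdd 8 (q₁.bdd.1 9)
          refine ⟨_, Runs.ite_true r₂.bdd hc (q₁.seq q₂),
            (hA₂.setReg (by omega) _).setReg (by omega) _, ?_, ?_, ?_, ?_⟩
          · simp [State.setReg_reg, f9]
          · simpa [State.setReg_reg, Term.eval, f9] using hlt
          · simp [State.setReg_reg, Term.eval, f9, f10]
          · intro j hj
            simp only [Term.eval, f9, f7, f10] at hc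
            simp only [State.setReg_reg, Term.eval, f10, if_true, if_false,
              Nat.reduceEqDiff]
            rcases Nat.lt_succ_iff_lt_or_eq.mp hj with h | h
            · exact le_trans (by omega) ((hbest (by omega)).2.2 j h)
            · exact h ▸ le_rfl
      have r₄ := Runs.assign (e := .add (.reg 9) (.const 1)) r₃.bdd 9 (by
        have := hM.le
        simp only [Term.eval, g9]
        omega)
      refine ⟨_, r₁.seq (r₂.seq (r₃.seq r₄)), ⟨hA₃.setReg (by omega) _, ?_, ?_⟩, ?_⟩
      · simp only [State.setReg_reg, Term.eval, if_true, g9]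
        omega
      · intro _
        simp only [State.setReg_reg, Term.eval, if_true, if_false, g9, Nat.reduceEqDiff]
        exact ⟨g8, g7, gle⟩
      · simp only [State.setReg_reg, Term.eval, if_true, g9]
        omega)
  refine ⟨s', h1.seq h2, hA, ?_⟩
  simp only [Term.eval, (hI.of_agree (by omega) hA).reg_two] at h0
  obtain ⟨b1, b2, b3⟩ := hbest (by omega)
  exact ⟨b1, fun j hj => b2.symm.le.trans (b3 j (by omega))⟩

/-- Register 9 saves the previous owner before it is overwritten, with 0 standing for none. In that
case register 6 is computed from the already incremented register 5, whence `+ 2`. -/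
lemma runs_placeBid (hs : s.Bdd M) (h2 : s.arr 2 (s.reg 8) + 1 ≤ M) (h5 : s.reg 5 + 2 ≤ M) :
    ∃ s', Runs M placeBid s s' ∧ s'.arr 0 = s.arr 0 ∧
      s'.arr 1 = Function.update (s.arr 1) (s.reg 8) (s.reg 6) ∧
      s'.arr 2 = Function.update (s.arr 2) (s.reg 8) (s.arr 2 (s.reg 8) + 1) ∧
      (∀ r < 5, s'.reg r = s.reg r) ∧
      s'.reg 5 = (if s.arr 1 (s.reg 8) = 0 then s.reg 5 + 1 else s.reg 5) ∧
      s'.reg 6 = (if s.arr 1 (s.reg 8) = 0 then s.reg 5 + 2 else s.arr 1 (s.reg 8)) := by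
  have r₁ := Runs.store (e := .add (.get 2 (.reg 8)) (.const 1)) (i := .reg 8) hs 2 h2
  have r₂ := Runs.assign (e := .get 1 (.reg 8)) r₁.bdd 9 (r₁.bdd.2 _ _)
  have r₃ := Runs.store (e := .reg 6) (i := .reg 8) r₂.bdd 1 (r₂.bdd.1 _)
  by_cases hc : s.arr 1 (s.reg 8) = 0
  · have r₄ := Runs.assign (e := .add (.reg 5) (.const 1)) r₃.bdd 5 (by
      simp [Term.eval, State.setReg_reg]
      omega)
    have r₅ := Runs.assign (e := .add (.reg 5) (.const 1)) r₄.bdd 6 (by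
      simp [Term.eval, State.setReg_reg]
      omega)
    refine ⟨_, r₁.seq (r₂.seq (r₃.seq (Runs.ite_false r₃.bdd ?_ (r₄.seq r₅)))), ?_⟩
    · simp [Term.eval, State.setReg_reg, State.setArr_arr, hc]
    · simp [Term.eval, State.setReg_reg, State.setArr_arr, hc]
      intros; split_ifs <;> omega
  · have r₄ := Runs.assign (e := .reg 9) r₃.bdd 6 (r₃.bdd.1 _)
    refine ⟨_, r₁.seq (r₂.seq (r₃.seq (Runs.ite_true r₃.bdd ?_ r₄))), ?_⟩
    · simp [Term.eval, State.setReg_reg, State.setArr_arr, hc]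
    · simp [Term.eval, State.setReg_reg, State.setArr_arr, hc]
      intros; split_ifs <;> omega

lemma runs_readInput (hs : s.Bdd M) (h1 : 1 ≤ M) :
    ∃ s', Runs M readInput s s' ∧ s'.arr = s.arr ∧
      HasInput (s.arr 0) (s.arr 0 0) (s.arr 0 1) (s.arr 0 2) s' ∧ s'.reg 5 = 0 ∧ s'.reg 6 = 1 := by
  have r₁ := Runs.assign (e := .get 0 (.const 0)) hs 2 (hs.2 _ _)
  have r₂ := Runs.assign (e := .get 0 (.const 1)) r₁.bdd 3 (r₁.bdd.2 _ _)
  have r₃ := Runs.assign (e := .get 0 (.const 2)) r₂.bdd 4 (r₂.bdd.2 _ _)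
  have r₄ := Runs.assign (e := .const 0) r₃.bdd 5 (Nat.zero_le M)
  have r₅ := Runs.assign (e := .const 1) r₄.bdd 6 h1
  refine ⟨_, r₁.seq (r₂.seq (r₃.seq (r₄.seq r₅))), rfl, ⟨rfl, ?_, ?_, ?_⟩, ?_, ?_⟩ <;>
  simp [Term.eval, State.setReg_reg]

lemma runs_writeOutput (hs : s.Bdd M) (hM : Large m n k M) (hI : HasInput f m n k s) :
    ∃ s', Runs M writeOutput s s' ∧ s'.reg 1 = n * k ∧
      s'.reg 0 = ∑ j ∈ Finset.range m, matchWeight f m n k (s.arr 1 j - 1) j := by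
  obtain ⟨s₁, r₁, hA₁, hv₁⟩ := runs_sumLoop (q := 7) (n := m) (bound := .reg 2)
    (body := weightLoop 9 (.sub (.get 1 (.reg 8)) (.const 1)) (.reg 8))
    (fun j => matchWeight f m n k (s.arr 1 j - 1) j) hs
    (fun u hA => (hI.of_agree (by omega) hA).reg_two) hM.le
    (by
      refine le_trans ?_ hM.sum_le
      simpa using Finset.sum_le_card_nsmul (Finset.range m) _ _
        fun j _ => matchWeight_le f m n k (s.arr 1 j - 1) j)
    (fun u hu hA _ => runs_weightLoop (by omega) hu hM (hI.of_agree (by omega) hA)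
      (fun v hv => by simp only [Term.eval, hv.1, hA.1, hv.2 8 (by omega)])
      (fun v hv => by simp only [Term.eval, hv.2 8 (by omega)]))
  have hI₁ := hI.of_agree (by omega) hA₁
  have r₂ := Runs.assign (e := .reg 7) r₁.bdd 0 (r₁.bdd.1 _)
  have r₃ := Runs.assign (e := .mul (.reg 3) (.reg 4)) r₂.bdd 1 (by
    simpa [Term.eval, State.setReg_reg, hI₁.reg_three, hI₁.reg_four] using hM.mul_le)
  refine ⟨_, r₁.seq (r₂.seq r₃), ?_, ?_⟩
  · simp [Term.eval, State.setReg_reg, hI₁.reg_three, hI₁.reg_four]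
  · simp [Term.eval, State.setReg_reg, hv₁]

lemma runs_posDistMain (hs : s.Bdd M) (hM : Large m n k M) (hm : s.arr 0 0 = m)
    (hn : s.arr 0 1 = n) (hk : s.arr 0 2 = k) (h1 : s.arr 1 = fun _ => 0)
    (h2 : s.arr 2 = fun _ => 0) :
    ∃ (s' : State) (σ : Equiv.Perm (Fin m)), Runs M posDistMain s s' ∧ s'.reg 1 = n * k ∧
      s'.reg 0 = ∑ j, matchWeight (s.arr 0) m n k (σ j) j ∧ ∀ τ : Equiv.Perm (Fin m),
        s'.reg 0 ≤ ∑ j, matchWeight (s.arr 0) m n k (τ j) j := by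
  obtain ⟨s₁, r₁, hA₁, hI₁, h5, h6⟩ := runs_readInput hs hM.one_le
  rw [hm, hn, hk] at hI₁
  set B := m * (k * (n * m) + n * (k * m)) with hB
  set f := s.arr 0 with hf
  obtain ⟨s₂, r₂, ⟨hI₂, hinv⟩, h0⟩ := Runs.loop (b := .sub (.reg 2) (.reg 5))
    (P := .seq bestColumn placeBid)
    (fun u => HasInput f m n k u ∧ AuctionInv m (matchWeight f m n k) B (u.reg 5) (u.reg 6)
      (u.arr 1) (u.arr 2))
    -- The measure is the distance of the sum of prices from its upper bound.
    (fun u => m * ((m + 1) * B + 1) - ∑ j ∈ Finset.range m, u.arr 2 j) r₁.bdd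
    ⟨hI₁, by rw [h5, h6, hA₁, h1, h2]; exact AuctionInv.start _ _ _⟩
    ((Nat.sub_le _ _).trans hM.rounds_le) (by
      rintro u hu ⟨hI, hinv⟩ hb
      have hlt : u.reg 5 < m := by
        simp only [Term.eval, hI.reg_two] at hb
        omega
      obtain ⟨v, q₁, hA, hj, hmin⟩ := runs_bestColumn hu hM hI (by omega) hinv.price_le
      have hIv := hI.of_agree (by omega) hA
      obtain ⟨w, q₂, w0, w1, w2, wr, w5, w6⟩ := runs_placeBid q₁.bdd
        (by
          rw [hA.1]
          have := hinv.price_le _ hj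
          have := hM.bid_le
          rw [← hB] at this
          omega)
        (by
          rw [hA.2 5 (by omega)]
          have := hM.succ_le
          omega)
      rw [hA.1, hA.2 6 (by omega)] at w1
      rw [hA.1] at w2
      rw [hA.1, hA.2 5 (by omega)] at w5 w6
      refine ⟨w, q₁.seq q₂, ⟨⟨?_, ?_, ?_, ?_⟩, ?_⟩, ?_⟩
      · rw [w0, hIv.arr_zero]
      · rw [wr 2 (by omega), hIv.reg_two]
      · rw [wr 3 (by omega), hIv.reg_three]
      · rw [wr 4 (by omega), hIv.reg_four]
      · rw [w1, w2, w5, w6]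
        exact hinv.bid hlt (fun i _ j _ => matchWeight_le f m n k i j) hj hmin
      · have hinv' := (hinv.bid hlt (fun i _ j _ => matchWeight_le f m n k i j) hj hmin).sum_price_le
        rw [w2, AuctionInv.sum_update_price hj]
        rw [AuctionInv.sum_update_price hj] at hinv'
        omega)
  have hrows : s₂.reg 5 = m := by
    have := hinv.rows_le
    simp only [Term.eval, hI₂.reg_two] at h0
    omega
  rw [hrows] at hinv
  obtain ⟨σ, hσ, hopt⟩ := hinv.optimal
  obtain ⟨s₃, r₃, e1, e0⟩ := runs_writeOutput r₂.bdd hM hI₂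
  have e0' : s₃.reg 0 = ∑ j, matchWeight f m n k (σ j) j := by
    rw [e0, Finset.sum_range]
    exact Finset.sum_congr rfl fun j _ => by rw [hσ, Nat.add_sub_cancel]
  exact ⟨s₃, σ, r₁.seq (r₂.seq r₃), e1, e0', fun τ => e0' ▸ hopt τ⟩

end RAM

/-! ### Positionwise distance and matchings of minimum weight -/

section Positionwise

variable {C D : Type*} {m n k : ℕ}

/-- In the flattened list, the quotient of an index by `m` is the voter and the remainder is the
position; `countUpTo` relies on this. -/
lemma Election.encode_eq_ofFn (e : C ≃ Fin m) (E : Election C m n) :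
    E.encode e = List.ofFn fun t : Fin (n * m) => ((e (E.vote t.divNat t.modNat) : Fin m) : ℕ) := by
  rw [List.ofFn_mul, Election.encode]
  congr 2
  funext v
  congr 1
  funext i
  have h : (⟨v * m + i, by
      calc (v : ℕ) * m + i < (v + 1) * m := by rw [Nat.succ_mul]; omega
        _ ≤ n * m := Nat.mul_le_mul_right m v.2⟩ : Fin (n * m)) = finProdFinEquiv (v, i) := by
    ext
    simp [Nat.mul_comm, Nat.add_comm]
  have h' := finProdFinEquiv.symm_apply_apply (v, i)
  rw [← h] at h'
  simp only [finProdFinEquiv_symm_apply, Prod.mk.injEq] at h'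
  rw [h'.1, h'.2]

lemma Election.length_encode (e : C ≃ Fin m) (E : Election C m n) :
    (E.encode e).length = n * m := by
  rw [Election.encode_eq_ofFn, List.length_ofFn]

lemma Election.getD_encode (e : C ≃ Fin m) (E : Election C m n) (v : Fin n) (i : Fin m) :
    (E.encode e).getD (i + m * v) 0 = e (E.vote v i) := by
  have hlt : (i : ℕ) + m * v < n * m := (finProdFinEquiv (v, i)).2
  have h' := finProdFinEquiv.symm_apply_apply (v, i)
  simp only [finProdFinEquiv_symm_apply, Prod.mk.injEq] at h'
  rw [Election.encode_eq_ofFn, List.getD_eq_getElem _ _ (by simpa using hlt), List.getElem_ofFn]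
  have h : (⟨(i : ℕ) + m * v, hlt⟩ : Fin (n * m)) = finProdFinEquiv (v, i) := rfl
  rw [h, h'.1, h'.2]

/-- Split the indices into pairs of voter and position. The remainder test keeps the positions up to
`x`, and for each of them the inner sum counts the voters who place `c` there. -/
lemma countUpTo_eq_sum_posCount (e : C ≃ Fin m) (E : Election C m n) (f : ℕ → ℕ) (off : ℕ)
    (hf : ∀ (v : Fin n) (i : Fin m), f (off + (i + m * v)) = e (E.vote v i)) (c : C) (x : Fin m) :
    countUpTo f m off (n * m) (e c) x = ∑ l ∈ Finset.Iic x, E.posCount c l := by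
  rw [countUpTo, Finset.sum_range, ← finProdFinEquiv.sum_comp, Fintype.sum_prod_type_right,
    ← Finset.sum_subset (Finset.subset_univ (Finset.Iic x))]
  · refine Finset.sum_congr rfl fun l hl => ?_
    have hl' : l ≤ x := Finset.mem_Iic.mp hl
    rw [Fin.le_def] at hl'
    rw [Election.posCount, Finset.card_filter]
    refine Finset.sum_congr rfl fun v _ => ?_
    have h1 : ((finProdFinEquiv (v, l) : Fin (n * m)) : ℕ) = l + m * v := rfl
    rw [h1]
    refine if_congr ?_ rfl rfl
    rw [hf, Fin.val_inj, e.apply_eq_iff_eq, Nat.add_mul_mod_self_left, Nat.mod_eq_of_lt l.2,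
      Ranking.pos, Equiv.symm_apply_eq, and_iff_left hl']
    exact eq_comm
  · intro l _ hl
    have hl' : ¬ (l : ℕ) ≤ x := fun h => hl (Finset.mem_Iic.mpr (Fin.le_def.mpr h))
    refine Finset.sum_eq_zero fun v _ => ?_
    simp [Nat.mod_eq_of_lt l.2, hl']

lemma Election.sum_posCount (E : Election C m n) (c : C) : ∑ i, E.posCount c i = n := by
  have := Finset.card_eq_sum_card_fiberwise (s := (Finset.univ : Finset (Fin n)))
    (t := (Finset.univ : Finset (Fin m))) (f := fun v => Ranking.pos (E.vote v) c)
    fun _ _ => Finset.mem_coe.mpr (Finset.mem_univ _)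
  rw [Finset.card_univ, Fintype.card_fin] at this
  exact this.symm

lemma Election.sum_freq (E : Election C m n) (hn : 0 < n) (c : C) : ∑ i, E.freq c i = 1 := by
  simp only [Election.freq]
  rw [← Finset.sum_div, ← Nat.cast_sum, E.sum_posCount, div_self (by positivity)]

lemma Election.freq_nonneg (E : Election C m n) (c : C) : 0 ≤ E.freq c := fun i => by
  simp only [Election.freq, Pi.zero_apply]
  positivity

lemma Election.prefixSum_freq (E : Election C m n) (c : C) (x : Fin m) :
    prefixSum (E.freq c) x = ((∑ l ∈ Finset.Iic x, E.posCount c l : ℕ) : ℝ) / n := by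
  simp only [prefixSum, Election.freq]
  rw [← Finset.sum_div, Nat.cast_sum]

/-- One of the two truncated differences vanishes, so their sum is the absolute difference of the
numerators over the common denominator. -/
lemma abs_div_sub_div_eq (a b : ℕ) (hn : 0 < n) (hk : 0 < k) :
    |(a : ℝ) / n - b / k| = (((k * a - n * b) + (n * b - k * a) : ℕ) : ℝ) / ((n * k : ℕ) : ℝ) := by
  have hn' : (0 : ℝ) < n := by exact_mod_cast hn
  have hk' : (0 : ℝ) < k := by exact_mod_cast hk
  have h : (a : ℝ) / n - b / k = ((k * a : ℕ) - (n * b : ℕ) : ℝ) / ((n * k : ℕ) : ℝ) := by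
    push_cast
    field_simp
  rw [h, abs_div, abs_of_pos (show (0 : ℝ) < ((n * k : ℕ) : ℝ) by positivity)]
  congr 1
  rcases le_total (k * a) (n * b) with h | h
  · rw [Nat.sub_eq_zero_of_le h, zero_add, Nat.cast_sub h, abs_sub_comm, abs_of_nonneg]
    exact sub_nonneg.mpr (by exact_mod_cast h)
  · rw [Nat.sub_eq_zero_of_le h, add_zero, Nat.cast_sub h, abs_of_nonneg]
    exact sub_nonneg.mpr (by exact_mod_cast h)

variable (eC : C ≃ Fin m) (E : Election C m n) (eD : D ≃ Fin m) (F : Election D m k)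

lemma getD_encodePair_left (v : Fin n) (i : Fin m) :
    (encodePair eC E eD F).getD (3 + (i + m * v)) 0 = eC (E.vote v i) := by
  have hlt : (i : ℕ) + m * v < n * m := (finProdFinEquiv (v, i)).2
  rw [← E.getD_encode, Nat.add_comm 3, encodePair, List.getD_cons_succ, List.getD_cons_succ,
    List.getD_cons_succ, List.getD_append _ _ _ _ (by rwa [E.length_encode])]

lemma getD_encodePair_right (v : Fin k) (i : Fin m) :
    (encodePair eC E eD F).getD (3 + n * m + (i + m * v)) 0 = eD (F.vote v i) := by
  rw [← F.getD_encode, Nat.add_assoc, Nat.add_comm 3, encodePair, List.getD_cons_succ,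
    List.getD_cons_succ, List.getD_cons_succ,
    List.getD_append_right _ _ _ _ (by rw [E.length_encode]; omega), E.length_encode,
    Nat.add_sub_cancel_left]

lemma emd_freq_eq (hn : 0 < n) (hk : 0 < k) (c : C) (d : D) :
    emd (E.freq c) (F.freq d) =
      (matchWeight (fun t => (encodePair eC E eD F).getD t 0) m n k (eC c) (eD d) : ℝ) /
        ((n * k : ℕ) : ℝ) := by
  rw [emd_eq_prefixDist (E.freq_nonneg c) (F.freq_nonneg d) (by rw [E.sum_freq hn, F.sum_freq hk]),
    prefixDist, matchWeight, Finset.sum_range, Nat.cast_sum, Finset.sum_div]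
  refine Finset.sum_congr rfl fun x _ => ?_
  rw [E.prefixSum_freq, F.prefixSum_freq, abs_div_sub_div_eq _ _ hn hk, prefixWeight,
    countUpTo_eq_sum_posCount eC E _ 3 (getD_encodePair_left eC E eD F),
    countUpTo_eq_sum_posCount eD F _ (3 + n * m) (getD_encodePair_right eC E eD F)]

/-- The permutation `τ` runs opposite to `δ`, from numbers of candidates in `D` to numbers in `C`,
because the auction records the owning row of each column. -/
lemma posDistVia_eq [Fintype C] (hn : 0 < n) (hk : 0 < k) (δ : C ≃ D) (τ : Equiv.Perm (Fin m))
    (h : ∀ c, τ (eD (δ c)) = eC c) :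
    posDistVia E F δ =
      ((∑ j, matchWeight (fun t => (encodePair eC E eD F).getD t 0) m n k (τ j) j : ℕ) : ℝ) /
        ((n * k : ℕ) : ℝ) := by
  rw [posDistVia, ← (δ.trans eD).sum_comp, Nat.cast_sum, Finset.sum_div]
  refine Finset.sum_congr rfl fun c _ => ?_
  rw [emd_freq_eq eC E eD F hn hk, Equiv.trans_apply, h]

lemma posDist_eq_div [Fintype C] (hn : 0 < n) (hk : 0 < k) (σ : Equiv.Perm (Fin m)) {a : ℕ}
    (ha : a = ∑ j, matchWeight (fun t => (encodePair eC E eD F).getD t 0) m n k (σ j) j)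
    (hmin : ∀ τ : Equiv.Perm (Fin m),
      a ≤ ∑ j, matchWeight (fun t => (encodePair eC E eD F).getD t 0) m n k (τ j) j) :
    posDist E F = (a : ℝ) / ((n * k : ℕ) : ℝ) := by
  refine IsLeast.csInf_eq ⟨⟨(eC.trans σ.symm).trans eD.symm, ?_⟩, ?_⟩
  · rw [ha]
    exact posDistVia_eq eC E eD F hn hk _ σ fun c => by simp
  · rintro _ ⟨δ, rfl⟩
    have h := posDistVia_eq eC E eD F hn hk δ ((eD.symm.trans δ.symm).trans eC) fun c => by simp
    simp only [h]
    gcongr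
    exact hmin _

lemma posDist_of_isEmpty [Fintype C] [IsEmpty C] [IsEmpty D] : posDist E F = 0 := by
  have : Nonempty (C ≃ D) := ⟨Equiv.equivOfIsEmpty C D⟩
  simp [posDist, posDistVia]

end Positionwise

/-! ### The main theorem -/

namespace RAM

/-! ### Bounding the memory contents by the input size -/

lemma length_le_inputSize (w : List ℕ) : w.length ≤ inputSize w := by
  induction w with
  | nil => exact Nat.zero_le _
  | cons a w ih =>
    rw [inputSize, List.map_cons, List.sum_cons, List.length_cons]
    rw [inputSize] at ih
    omega

lemma init_bdd {w : List ℕ} {M : ℕ} (hl : w.length ≤ M) (hw : ∀ a ∈ w, a ≤ M) :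
    (init w).Bdd M := by
  constructor
  · intro r
    simp only [init]
    split_ifs <;> omega
  · intro a i
    simp only [init]
    split_ifs
    · by_cases hi : i < w.length
      · rw [List.getD_eq_getElem _ _ hi]
        exact hw _ (List.getElem_mem hi)
      · rw [List.getD_eq_default _ _ (by omega)]
        exact Nat.zero_le M
    · exact Nat.zero_le M

/-- Positivity of `m` gives `n ≤ n * m` and `k ≤ k * m`, so all parameters are at most `N`. The
degree 5 comes from the number of bids, the factor 10 from the bound `8 * N ^ 4 + 2` on bids. -/
lemma large_of_le {m n k N : ℕ} (hm : 0 < m) (hn : 0 < n) (hN : 3 + (n * m + k * m) ≤ N) :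
    Large m n k (10 * N ^ 5) := by
  have hmn : m ≤ n * m := Nat.le_mul_of_pos_left m hn
  have hnm : n ≤ n * m := Nat.le_mul_of_pos_right n hm
  have hkm : k ≤ k * m := Nat.le_mul_of_pos_right k hm
  have h1 : 1 ≤ N := by omega
  have a1 : m ≤ N := by omega
  have a2 : n ≤ N := by omega
  have a3 : k ≤ N := by omega
  have a4 : n * m ≤ N := by omega
  have a5 : k * m ≤ N := by omega
  have a6 : m + 1 ≤ 2 * N := by omega
  have p1 : N ≤ N ^ 5 := Nat.le_self_pow (by omega) N
  have p2 : N ^ 2 ≤ N ^ 5 := Nat.pow_le_pow_right h1 (by omega)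
  have p4 : N ^ 4 ≤ N ^ 5 := Nat.pow_le_pow_right h1 (by omega)
  have hB : m * (k * (n * m) + n * (k * m)) ≤ 2 * N ^ 3 :=
    calc _ ≤ N * (N * N + N * N) := by gcongr
      _ = _ := by ring
  have hb : (m + 1) * (m * (k * (n * m) + n * (k * m))) ≤ 4 * N ^ 4 :=
    calc _ ≤ 2 * N * (2 * N ^ 3) := by gcongr
      _ = _ := by ring
  refine ⟨by omega, ?_, by omega, by omega, ?_, ?_, by omega, ?_⟩
  · calc n * k ≤ N * N := by gcongr
      _ = N ^ 2 := by ring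
      _ ≤ _ := by omega
  · calc k * (n * m) + n * (k * m) ≤ N * N + N * N := by gcongr
      _ = 2 * N ^ 2 := by ring
      _ ≤ _ := by omega
  · calc _ ≤ N * (2 * N ^ 3) := by gcongr
      _ = 2 * N ^ 4 := by ring
      _ ≤ _ := by omega
  · calc _ ≤ N * (4 * N ^ 4 + 1) := by gcongr
      _ = 4 * N ^ 5 + N := by ring
      _ ≤ _ := by omega

lemma encodePair_le {C D : Type*} {m n k : ℕ} (eC : C ≃ Fin m) (E : Election C m n)
    (eD : D ≃ Fin m) (F : Election D m k) {M : ℕ} (hm : m ≤ M) (hn : n ≤ M) (hk : k ≤ M) :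
    ∀ a ∈ encodePair eC E eD F, a ≤ M := by
  intro a ha
  simp only [encodePair, List.mem_cons, List.mem_append, Election.encode_eq_ofFn,
    List.mem_ofFn] at ha
  rcases ha with rfl | rfl | rfl | ⟨t, rfl⟩ | ⟨t, rfl⟩
  · exact hm
  · exact hn
  · exact hk
  · exact (Fin.is_lt _).le.trans hm
  · exact (Fin.is_lt _).le.trans hm

end RAM

theorem mainTheorem4 :
    ∃ (P : RAM.Prog) (p : Polynomial ℕ),
      ∀ (C D : Type*) [Fintype C] (m n k : ℕ) (eC : C ≃ Fin m) (eD : D ≃ Fin m)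
        (E : Election C m n) (F : Election D m k), 0 < n → 0 < k →
        ∃ (s : RAM.State) (t : ℕ),
          RAM.Exec P (RAM.init (encodePair eC E eD F)) s t ∧
          t ≤ p.eval (RAM.inputSize (encodePair eC E eD F)) ∧
          0 < s.reg 1 ∧
          posDist E F = (s.reg 0 : ℝ) / (s.reg 1 : ℝ) := by
  obtain ⟨p, hp⟩ := RAM.posDistProg.exists_timeBound_eq
  refine ⟨RAM.posDistProg, p.comp (Polynomial.C 10 * Polynomial.X ^ 5) + Polynomial.C 20, ?_⟩
  intro C D _ m n k eC eD E F hn hk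
  rcases Nat.eq_zero_or_pos m with rfl | hm
  -- Without candidates the votes are empty, so `n` and `k`, written in binary, can be exponential
  -- in the input size and the bound on memory contents would fail. The separate branch has constant
  -- cost, covered by the summand 20.
  · have : IsEmpty C := eC.isEmpty
    have : IsEmpty D := eD.isEmpty
    refine ⟨_, _, .ite_false rfl (.seq (.assign _ _ _) (.assign _ _ _)), ?_, ?_, ?_⟩
    · rw [Polynomial.eval_add, Polynomial.eval_C]
      refine le_trans ?_ (Nat.le_add_left 20 _)
      simp [RAM.Term.cost, RAM.Term.eval, RAM.init, encodePair]
    · simp [RAM.Term.eval]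
    · rw [posDist_of_isEmpty]
      simp [RAM.Term.eval]
  · set w := encodePair eC E eD F with hw
    have hlen : w.length = 3 + (n * m + k * m) := by
      simp only [hw, encodePair, List.length_cons, List.length_append, Election.length_encode]
      omega
    have hN := RAM.length_le_inputSize w
    rw [hlen] at hN
    have hM := RAM.large_of_le hm hn hN
    have hkm : k ≤ k * m := Nat.le_mul_of_pos_right k hm
    have hnm : n ≤ n * m := Nat.le_mul_of_pos_right n hm
    have hbdd : (RAM.init w).Bdd (10 * RAM.inputSize w ^ 5) := by
      refine RAM.init_bdd ?_ (RAM.encodePair_le eC E eD F hM.le (hnm.trans hM.left_le)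
        (hkm.trans hM.right_le))
      rw [hlen]
      have := Nat.le_self_pow (show 5 ≠ 0 by decide) (RAM.inputSize w)
      omega
    obtain ⟨s, σ, hrun, h1, h0, hmin⟩ := RAM.runs_posDistMain hbdd hM rfl rfl rfl rfl rfl
    obtain ⟨_, t, ht, hexec⟩ := RAM.Runs.ite_true (b := .get 0 (.const 0))
      (Q := .seq (.assign 0 (.const 0)) (.assign 1 (.const 1))) hbdd hm.ne' hrun
    refine ⟨s, t, hexec, ?_, ?_, ?_⟩
    · refine ht.trans ((hp _).le.trans ?_)
      simp [Polynomial.eval_comp]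
    · rw [h1]
      exact Nat.mul_pos hn hk
    · rw [h1]
      exact posDist_eq_div eC E eD F hn hk σ h0 hmin
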